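/- For a matroid $M$ on a finite ground set $E$, an automorphism of $M$ is a bijection $\phi:E\to E$ such that, for all $C\subseteq E$, $\phi(C)$ is a circuit of $M$ if and only if $C$ is a circuit of $M$. A fixing set is a set $S\subseteq E$ such that the only automorphism of $M$ fixing every element of $S$ is the identity, and the fixing number $\mathrm{fix}(M)$ is the minimum size of a fixing set. For a finite graph $G$, the cycle matroid $M(G)$ is the matroid on the edge set of $G$ whose circuits are the edge sets of the cycles of $G$. The bicircular matroid $B(G)$ is the matroid on the edge set of $G$ whose circuits are the edge sets of the bicycles of $G$, i.e. of the subgraphs that are subdivisions of one of the following graphs: two loops incident to the same vertex, two loops joined by an edge, or three edges joining the same pair of vertices. Let $K_n$ be the complete graph on $n$ vertices. Then: 1. $\mathrm{fix}(M(K_n)) = \lfloor 2n/3 \rfloor$ for all $n \ge 1$ with $n \ne 2$, and $\mathrm{fix}(M(K_2)) = 0$. 2. $\mathrm{fix}(B(K_4)) = 5$, $\mathrm{fix}(B(K_2)) = 0$, and $\mathrm{fix}(B(K_n)) = \lfloor 2n/3 \rfloor$ for all integers $n \ge 0$ with $n \ne 2$ and $n \ne 4$. -/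

import Mathlib

/-! ### Cycles and bicycles of a graph, as sets of edges -/

namespace SimpleGraph

variable {V : Type*}

/-- `C` is the edge set of a cycle of `G`. -/
def IsCycleEdgeSet (G : SimpleGraph V) (C : Set (Sym2 V)) : Prop :=
  ∃ (u : V) (c : G.Walk u u), c.IsCycle ∧ C = c.edgeSet

/-- `C` is the edge set of a theta graph in `G`, that is, of a subdivision of three edges joining
the same pair of vertices: three paths between two distinct vertices `u`, `v`, no two of which
share an edge or a vertex other than `u` and `v`. -/
def IsThetaEdgeSet (G : SimpleGraph V) (C : Set (Sym2 V)) : Prop :=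
  ∃ (u v : V) (p q r : G.Walk u v), u ≠ v ∧ p.IsPath ∧ q.IsPath ∧ r.IsPath ∧
    (∀ w, w ∈ p.support → w ∈ q.support → w = u ∨ w = v) ∧
    (∀ w, w ∈ p.support → w ∈ r.support → w = u ∨ w = v) ∧
    (∀ w, w ∈ q.support → w ∈ r.support → w = u ∨ w = v) ∧
    Disjoint p.edgeSet q.edgeSet ∧ Disjoint p.edgeSet r.edgeSet ∧ Disjoint q.edgeSet r.edgeSet ∧
    C = p.edgeSet ∪ q.edgeSet ∪ r.edgeSet

/-- `C` is the edge set of a tight handcuff in `G`, that is, of a subdivision of two loops incident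
to the same vertex: two cycles with exactly one common vertex `u`. -/
def IsTightHandcuffEdgeSet (G : SimpleGraph V) (C : Set (Sym2 V)) : Prop :=
  ∃ (u : V) (c d : G.Walk u u), c.IsCycle ∧ d.IsCycle ∧
    (∀ w, w ∈ c.support → w ∈ d.support → w = u) ∧
    C = c.edgeSet ∪ d.edgeSet

/-- `C` is the edge set of a loose handcuff in `G`, that is, of a subdivision of two loops joined
by an edge: two vertex-disjoint cycles together with a path from a vertex `u` of the first one to
a vertex `v` of the second one, which meets the cycles only in `u` and `v`. -/
def IsLooseHandcuffEdgeSet (G : SimpleGraph V) (C : Set (Sym2 V)) : Prop :=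
  ∃ (u v : V) (c : G.Walk u u) (d : G.Walk v v) (p : G.Walk u v),
    c.IsCycle ∧ d.IsCycle ∧ p.IsPath ∧
    (∀ w, w ∈ c.support → w ∉ d.support) ∧
    (∀ w, w ∈ c.support → w ∈ p.support → w = u) ∧
    (∀ w, w ∈ d.support → w ∈ p.support → w = v) ∧
    C = c.edgeSet ∪ d.edgeSet ∪ p.edgeSet

/-- `C` is the edge set of a bicycle of `G`. -/
def IsBicycleEdgeSet (G : SimpleGraph V) (C : Set (Sym2 V)) : Prop :=
  G.IsThetaEdgeSet C ∨ G.IsTightHandcuffEdgeSet C ∨ G.IsLooseHandcuffEdgeSet C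

/-! ### The cycle matroid -/

/-- A set of edges of `G` is a forest if it contains no cycle of `G`. -/
def IsForestEdgeSet (G : SimpleGraph V) (I : Set (Sym2 V)) : Prop :=
  I ⊆ G.edgeSet ∧ ∀ C, G.IsCycleEdgeSet C → ¬ C ⊆ I

theorem edgeSet_fromEdgeSet_of_subset {G : SimpleGraph V} {I : Set (Sym2 V)}
    (hI : I ⊆ G.edgeSet) : (fromEdgeSet I).edgeSet = I := by
  rw [edgeSet_fromEdgeSet]
  ext e
  simp only [Set.mem_sdiff]
  exact ⟨fun h => h.1, fun h => ⟨h, fun h' => G.not_isDiag_of_mem_edgeSet (hI h) h'⟩⟩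

theorem isForestEdgeSet_iff {G : SimpleGraph V} {I : Set (Sym2 V)} (hI : I ⊆ G.edgeSet) :
    G.IsForestEdgeSet I ↔ (fromEdgeSet I).IsAcyclic := by
  have hle : fromEdgeSet I ≤ G := by
    rw [← edgeSet_subset_edgeSet, edgeSet_fromEdgeSet_of_subset hI]; exact hI
  constructor
  · rintro ⟨-, h⟩ v c hc
    refine h _ ⟨v, c.mapLe hle, hc.mapLe hle, rfl⟩ ?_
    rw [Walk.edgeSet_mapLe_eq_edgeSet]
    intro e he
    have := c.edges_subset_edgeSet he
    rwa [edgeSet_fromEdgeSet_of_subset hI] at this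
  · refine fun h => ⟨hI, ?_⟩
    rintro C ⟨v, c, hc, rfl⟩ hC
    have hmem : ∀ e ∈ c.edges, e ∈ (fromEdgeSet I).edgeSet := by
      intro e he
      rw [edgeSet_fromEdgeSet_of_subset hI]
      exact hC he
    exact h (c.transfer _ hmem) (hc.transfer hmem)

theorem isForestEdgeSet_aug (G : SimpleGraph V) {I B : Set (Sym2 V)} (hI : G.IsForestEdgeSet I)
    (hImax : ¬ Maximal G.IsForestEdgeSet I) (hB : Maximal G.IsForestEdgeSet B) :
    ∃ x ∈ B \ I, G.IsForestEdgeSet (insert x I) := by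
  have key : ∀ {J : Set (Sym2 V)}, G.IsForestEdgeSet J →
      (Maximal G.IsForestEdgeSet J ↔ (fromEdgeSet J).Reachable = G.Reachable) := by
    intro J hJ
    have hle : fromEdgeSet J ≤ G := by
      rw [← edgeSet_subset_edgeSet, edgeSet_fromEdgeSet_of_subset hJ.1]; exact hJ.1
    rw [← maximal_isAcyclic_iff_reachable_eq hle ((isForestEdgeSet_iff hJ.1).1 hJ)]
    constructor
    · refine fun h => ⟨⟨hle, (isForestEdgeSet_iff hJ.1).1 hJ⟩, fun F hF hJF => ?_⟩
      have hF' : G.IsForestEdgeSet F.edgeSet := by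
        rw [isForestEdgeSet_iff (edgeSet_subset_edgeSet.2 hF.1), fromEdgeSet_edgeSet]
        exact hF.2
      have h1 : J ⊆ F.edgeSet := by
        rw [← edgeSet_fromEdgeSet_of_subset hJ.1]; exact edgeSet_subset_edgeSet.2 hJF
      have h2 := h.2 hF' h1
      rw [← edgeSet_subset_edgeSet, edgeSet_fromEdgeSet_of_subset hJ.1]
      exact h2
    · refine fun h => ⟨hJ, fun K hK hJK => ?_⟩
      have hKle : fromEdgeSet K ≤ G := by
        rw [← edgeSet_subset_edgeSet, edgeSet_fromEdgeSet_of_subset hK.1]; exact hK.1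
      have h2 := h.2 ⟨hKle, (isForestEdgeSet_iff hK.1).1 hK⟩ (fromEdgeSet_mono hJK)
      have h3 := edgeSet_subset_edgeSet.2 h2
      rwa [edgeSet_fromEdgeSet_of_subset hJ.1, edgeSet_fromEdgeSet_of_subset hK.1] at h3
  by_contra! hcon
  apply hImax
  rw [key hI]
  have hBr := (key hB.1).1 hB
  have hIac := (isForestEdgeSet_iff hI.1).1 hI
  have hIle : fromEdgeSet I ≤ G := by
    rw [← edgeSet_subset_edgeSet, edgeSet_fromEdgeSet_of_subset hI.1]; exact hI.1
  have hadj : ∀ x y, (fromEdgeSet B).Adj x y → (fromEdgeSet I).Reachable x y := by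
    intro x y hxy
    by_contra hr
    rw [fromEdgeSet_adj] at hxy
    have hxI : s(x, y) ∉ I := fun h =>
      hr (Adj.reachable ((fromEdgeSet_adj I).2 ⟨h, hxy.2⟩))
    refine hcon s(x, y) ⟨hxy.1, hxI⟩ ?_
    have hins : insert s(x, y) I ⊆ G.edgeSet :=
      Set.insert_subset (hB.1.1 hxy.1) hI.1
    rw [isForestEdgeSet_iff hins]
    have heq : fromEdgeSet (insert s(x, y) I) = fromEdgeSet I ⊔ edge x y := by
      rw [edge, ← fromEdgeSet_union, Set.union_singleton]
    rw [heq]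
    exact IsAcyclic.sup_edge_of_not_reachable hr hIac
  ext x y
  refine ⟨fun h => h.mono hIle, fun h => ?_⟩
  rw [← hBr] at h
  obtain ⟨w⟩ := h
  induction w with
  | nil => exact Reachable.refl _
  | cons h _ ih => exact (hadj _ _ h).trans ih

/-- The cycle matroid `M(G)` of a finite graph `G`: its ground set is the edge set of `G`, and a
set of edges is independent when it contains no cycle, so that the circuits are the cycles. -/
def cycleMatroid [Finite V] (G : SimpleGraph V) : Matroid (Sym2 V) :=
  IndepMatroid.matroid
    { E := G.edgeSet
      Indep := G.IsForestEdgeSet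
      indep_empty := by
        refine ⟨Set.empty_subset _, ?_⟩
        rintro C ⟨u, c, hc, rfl⟩ h
        cases c with
        | nil => exact hc.ne_nil rfl
        | cons h' p => exact h (show _ ∈ (Walk.cons h' p).edges by simp [Walk.edges_cons]; left; rfl)
      indep_subset := fun _ _ hJ hIJ => ⟨hIJ.trans hJ.1, fun C hC h => hJ.2 C hC (h.trans hIJ)⟩
      indep_aug := fun _ _ hI hImax hB => G.isForestEdgeSet_aug hI hImax hB
      indep_maximal := fun X _ => Matroid.existsMaximalSubsetProperty_of_bdd
        ⟨Set.ncard (Set.univ : Set (Sym2 V)), fun Y _ => by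
          rw [Set.Finite.cast_ncard_eq (Set.toFinite _)]
          exact Set.encard_le_encard (Set.subset_univ _)⟩ X
      subset_ground := fun _ hI => hI.1 }

/-! ### The bicircular matroid -/

/-- A set of edges of `G` is bicycle-free if it contains no bicycle of `G`. -/
def IsBicycleFree (G : SimpleGraph V) (I : Set (Sym2 V)) : Prop :=
  I ⊆ G.edgeSet ∧ ∀ C, G.IsBicycleEdgeSet C → ¬ C ⊆ I

open Classical in
/-- The vertices that are incident with an edge in `A`. -/
noncomputable def edgeVerts (A : Finset (Sym2 V)) : Finset V :=
  A.biUnion fun e => e.toFinset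

theorem mem_edgeVerts {A : Finset (Sym2 V)} {v : V} : v ∈ edgeVerts A ↔ ∃ e ∈ A, v ∈ e := by
  classical
  simp [edgeVerts]

theorem edgeVerts_mono {A B : Finset (Sym2 V)} (h : A ⊆ B) : edgeVerts A ⊆ edgeVerts B := by
  intro v hv
  rw [mem_edgeVerts] at *
  obtain ⟨e, he, hv⟩ := hv
  exact ⟨e, h he, hv⟩

/-- No set of edges in `I` has more elements than it has incident vertices. -/
def IsSparse (I : Set (Sym2 V)) : Prop :=
  ∀ A : Finset (Sym2 V), (A : Set (Sym2 V)) ⊆ I → A.card ≤ (edgeVerts A).card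

theorem isSparse_tight_union {I : Set (Sym2 V)} [DecidableEq (Sym2 V)] (hI : IsSparse I)
    {A B : Finset (Sym2 V)}
    (hA : (A : Set (Sym2 V)) ⊆ I) (hB : (B : Set (Sym2 V)) ⊆ I)
    (hA' : A.card = (edgeVerts A).card) (hB' : B.card = (edgeVerts B).card) :
    (A ∪ B).card = (edgeVerts (A ∪ B)).card := by
  classical
  have h1 := Finset.card_union_add_card_inter A B
  have h2 := Finset.card_union_add_card_inter (edgeVerts A) (edgeVerts B)
  have h3 : edgeVerts (A ∪ B) = edgeVerts A ∪ edgeVerts B := by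
    ext v; simp only [Finset.mem_union, mem_edgeVerts]; grind
  have h4 : edgeVerts (A ∩ B) ⊆ edgeVerts A ∩ edgeVerts B :=
    Finset.subset_inter (edgeVerts_mono Finset.inter_subset_left)
      (edgeVerts_mono Finset.inter_subset_right)
  have h5 := Finset.card_le_card h4
  have h6 := hI (A ∩ B) (by
    refine Set.Subset.trans ?_ hA
    exact_mod_cast Finset.inter_subset_left)
  have h7 := hI (A ∪ B) (by
    rw [Finset.coe_union]; exact Set.union_subset hA hB)
  rw [h3] at *
  omega

theorem isSparse_aug [Finite V] {I J : Set (Sym2 V)} (hI : IsSparse I) (hJ : IsSparse J)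
    (hIJ : I.ncard < J.ncard) : ∃ e ∈ J, e ∉ I ∧ IsSparse (insert e I) := by
  classical
  have := Fintype.ofFinite V
  by_contra! hcon
  lift I to Finset (Sym2 V) using Set.toFinite I
  lift J to Finset (Sym2 V) using Set.toFinite J
  rw [Set.ncard_coe_finset, Set.ncard_coe_finset] at hIJ
  -- the largest tight subset of `I`
  let T : Finset (Sym2 V) :=
    (I.powerset.filter fun A => A.card = (edgeVerts A).card).sup id
  have hT : T ⊆ I ∧ T.card = (edgeVerts T).card := by
    refine Finset.sup_induction (p := fun A => A ⊆ I ∧ A.card = (edgeVerts A).card) ?_ ?_ ?_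
    · simp [edgeVerts]
    · rintro A ⟨hA, hA'⟩ B ⟨hB, hB'⟩
      exact ⟨Finset.union_subset hA hB,
        isSparse_tight_union hI (by exact_mod_cast hA) (by exact_mod_cast hB) hA' hB'⟩
    · intro A hA
      simpa using hA
  have hTmax : ∀ A ⊆ I, A.card = (edgeVerts A).card → A ⊆ T := by
    intro A hA hA'
    exact Finset.le_sup (f := id) (by simp [hA, hA'])
  have hin : ∀ e ∈ J, e ∉ I → ∀ v ∈ e, v ∈ edgeVerts T := by
    intro e heJ heI v hv
    have h := hcon e (by exact_mod_cast heJ) (by exact_mod_cast heI)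
    unfold IsSparse at h
    push Not at h
    obtain ⟨A, hA, hlt⟩ := h
    have hA2 : A.erase e ⊆ I := by
      intro x hx
      rw [Finset.mem_erase] at hx
      have := hA (Finset.mem_coe.2 hx.2)
      rcases this with h | h
      · exact absurd h hx.1
      · exact_mod_cast h
    have heA : e ∈ A := by
      by_contra h
      rw [Finset.erase_eq_of_notMem h] at hA2
      have := hI A (by exact_mod_cast hA2)
      omega
    have h1 := hI (A.erase e) (by exact_mod_cast hA2)
    have h2 := Finset.card_le_card (edgeVerts_mono (Finset.erase_subset e A))
    rw [Finset.card_erase_of_mem heA] at h1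
    have h3 : (A.erase e).card = (edgeVerts (A.erase e)).card := by
      rw [Finset.card_erase_of_mem heA]; omega
    have h4 : edgeVerts (A.erase e) = edgeVerts A :=
      Finset.eq_of_subset_of_card_le (edgeVerts_mono (Finset.erase_subset e A)) (by omega)
    apply edgeVerts_mono (hTmax _ hA2 h3)
    rw [h4, mem_edgeVerts]
    exact ⟨e, heA, hv⟩
  let J₁ := J.filter fun e => ∀ v ∈ e, v ∈ edgeVerts T
  let J₂ := J.filter fun e => ¬ ∀ v ∈ e, v ∈ edgeVerts T
  have hJ12 : J₁.card + J₂.card = J.card := Finset.card_filter_add_card_filter_not _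
  have h1 : J₁.card ≤ T.card := by
    rw [hT.2]
    refine (hJ J₁ (by exact_mod_cast Finset.filter_subset _ _)).trans (Finset.card_le_card ?_)
    intro v hv
    rw [mem_edgeVerts] at hv
    obtain ⟨e, he, hv⟩ := hv
    exact (Finset.mem_filter.1 he).2 v hv
  have h2 : J₂ ⊆ I \ T := by
    intro e he
    rw [Finset.mem_filter] at he
    rw [Finset.mem_sdiff]
    refine ⟨?_, fun h => he.2 fun v hv => mem_edgeVerts.2 ⟨e, h, hv⟩⟩
    by_contra h
    exact he.2 (hin e he.1 h)
  have h3 := Finset.card_le_card h2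
  rw [Finset.card_sdiff_of_subset hT.1] at h3
  have h4 := Finset.card_le_card hT.1
  omega

theorem IsBicycleEdgeSet.mono {G H : SimpleGraph V} (h : G ≤ H) {C : Set (Sym2 V)}
    (hC : G.IsBicycleEdgeSet C) : H.IsBicycleEdgeSet C := by
  rcases hC with ⟨u, v, p, q, r, hC⟩ | ⟨u, c, d, hC⟩ | ⟨u, v, c, d, p, hC⟩
  · exact Or.inl ⟨u, v, p.mapLe h, q.mapLe h, r.mapLe h, by
      simpa [Walk.support_mapLe_eq_support, Walk.edgeSet_mapLe_eq_edgeSet] using hC⟩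
  · exact Or.inr (Or.inl ⟨u, c.mapLe h, d.mapLe h, by
      simpa [Walk.support_mapLe_eq_support, Walk.edgeSet_mapLe_eq_edgeSet] using hC⟩)
  · exact Or.inr (Or.inr ⟨u, v, c.mapLe h, d.mapLe h, p.mapLe h, by
      simpa [Walk.support_mapLe_eq_support, Walk.edgeSet_mapLe_eq_edgeSet] using hC⟩)

theorem disjoint_edges_of_common {G : SimpleGraph V} {a b c d : V} (p : G.Walk a b)
    (q : G.Walk c d) (x : V) (h : ∀ w, w ∈ p.support → w ∈ q.support → w = x) :
    p.edges.Disjoint q.edges := by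
  intro e he he'
  induction e with
  | _ y z =>
    have h1 := h y (p.fst_mem_support_of_mem_edges he) (q.fst_mem_support_of_mem_edges he')
    have h2 := h z (p.snd_mem_support_of_mem_edges he) (q.snd_mem_support_of_mem_edges he')
    exact (p.adj_of_mem_edges he).ne (h1.trans h2.symm)

theorem card_support_isCycle [DecidableEq V] {G : SimpleGraph V} {u : V} {c : G.Walk u u}
    (hc : c.IsCycle) : c.support.toFinset.card = c.length := by
  have h1 : c.support.toFinset = c.support.tail.toFinset := by
    ext w
    rw [List.mem_toFinset, List.mem_toFinset, Walk.mem_support_iff]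
    refine ⟨?_, Or.inr⟩
    rintro (rfl | h)
    · exact Walk.end_mem_tail_support hc.not_nil
    · exact h
  rw [h1, List.toFinset_card_of_nodup hc.support_nodup, List.length_tail, Walk.length_support]
  rfl

theorem IsBicycleEdgeSet.exists_finset {G : SimpleGraph V} {C : Set (Sym2 V)}
    (hC : G.IsBicycleEdgeSet C) :
    ∃ A : Finset (Sym2 V), (A : Set (Sym2 V)) = C ∧ (edgeVerts A).card < A.card := by
  classical
  rcases hC with ⟨u, v, p, q, r, huv, hp, hq, hr, h1, h2, h3, d1, d2, d3, rfl⟩ |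
    ⟨u, c, d, hc, hd, h1, rfl⟩ | ⟨u, v, c, d, p, hc, hd, hp, h1, h2, h3, rfl⟩
  · refine ⟨p.edges.toFinset ∪ q.edges.toFinset ∪ r.edges.toFinset, ?_, ?_⟩
    · ext e; simp [Walk.edgeSet, or_assoc]
    have hd1 : Disjoint p.edges.toFinset q.edges.toFinset := by
      rw [List.disjoint_toFinset_iff_disjoint]
      exact fun e he he' => Set.disjoint_left.1 d1 he he'
    have hd2 : Disjoint (p.edges.toFinset ∪ q.edges.toFinset) r.edges.toFinset := by
      rw [Finset.disjoint_union_left, List.disjoint_toFinset_iff_disjoint,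
        List.disjoint_toFinset_iff_disjoint]
      exact ⟨fun e he he' => Set.disjoint_left.1 d2 he he',
        fun e he he' => Set.disjoint_left.1 d3 he he'⟩
    rw [Finset.card_union_of_disjoint hd2, Finset.card_union_of_disjoint hd1,
      List.toFinset_card_of_nodup hp.isTrail.edges_nodup,
      List.toFinset_card_of_nodup hq.isTrail.edges_nodup,
      List.toFinset_card_of_nodup hr.isTrail.edges_nodup]
    have hsub : edgeVerts (p.edges.toFinset ∪ q.edges.toFinset ∪ r.edges.toFinset) ⊆
        p.support.toFinset ∪ (q.support.toFinset \ {u, v}) ∪ (r.support.toFinset \ {u, v}) := by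
      intro w hw
      rw [mem_edgeVerts] at hw
      obtain ⟨e, he, hw⟩ := hw
      have hu := p.start_mem_support
      have hv := p.end_mem_support
      simp only [Finset.mem_union, List.mem_toFinset, Finset.mem_sdiff, Finset.mem_insert,
        Finset.mem_singleton] at he ⊢
      have : w ∈ p.support ∨ w ∈ q.support ∨ w ∈ r.support := by
        rcases he with (he | he) | he
        · exact Or.inl (Walk.mem_support_of_mem_edges he hw)
        · exact Or.inr (Or.inl (Walk.mem_support_of_mem_edges he hw))
        · exact Or.inr (Or.inr (Walk.mem_support_of_mem_edges he hw))
      by_cases hwu : w = u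
      · subst hwu; tauto
      by_cases hwv : w = v
      · subst hwv; tauto
      tauto
    have hcard := Finset.card_le_card hsub
    have c1 := Finset.card_union_le (p.support.toFinset ∪ (q.support.toFinset \ {u, v}))
      (r.support.toFinset \ {u, v})
    have c2 := Finset.card_union_le p.support.toFinset (q.support.toFinset \ {u, v})
    have c3 : ∀ s : G.Walk u v, s.IsPath → (s.support.toFinset \ {u, v}).card = s.length - 1 := by
      intro s hs
      rw [Finset.card_sdiff_of_subset, List.toFinset_card_of_nodup hs.support_nodup,
        Finset.card_pair huv, Walk.length_support]
      · omega
      · intro w hw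
        simp only [Finset.mem_insert, Finset.mem_singleton] at hw
        rcases hw with rfl | rfl <;> simp
    have c4 : p.support.toFinset.card = p.length + 1 := by
      rw [List.toFinset_card_of_nodup hp.support_nodup, Walk.length_support]
    have c5 : ∀ s : G.Walk u v, 0 < s.length := by
      intro s
      by_contra h
      exact huv (Walk.eq_of_length_eq_zero (p := s) (by omega))
    have := c5 q
    have := c5 r
    rw [c3 q hq] at *
    rw [c3 r hr] at *
    simp only [Walk.length_edges]
    omega
  · refine ⟨c.edges.toFinset ∪ d.edges.toFinset, ?_, ?_⟩
    · ext e; simp [Walk.edgeSet]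
    have hd1 : Disjoint c.edges.toFinset d.edges.toFinset := by
      rw [List.disjoint_toFinset_iff_disjoint]
      exact disjoint_edges_of_common c d u h1
    rw [Finset.card_union_of_disjoint hd1,
      List.toFinset_card_of_nodup hc.isTrail.edges_nodup,
      List.toFinset_card_of_nodup hd.isTrail.edges_nodup]
    have hsub : edgeVerts (c.edges.toFinset ∪ d.edges.toFinset) ⊆
        c.support.toFinset ∪ (d.support.toFinset \ {u}) := by
      intro w hw
      rw [mem_edgeVerts] at hw
      obtain ⟨e, he, hw⟩ := hw
      have hu := c.start_mem_support
      simp only [Finset.mem_union, List.mem_toFinset, Finset.mem_sdiff,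
        Finset.mem_singleton] at he ⊢
      have : w ∈ c.support ∨ w ∈ d.support := by
        rcases he with he | he
        · exact Or.inl (Walk.mem_support_of_mem_edges he hw)
        · exact Or.inr (Walk.mem_support_of_mem_edges he hw)
      by_cases hwu : w = u
      · subst hwu; tauto
      tauto
    have hcard := Finset.card_le_card hsub
    have c1 := Finset.card_union_le c.support.toFinset (d.support.toFinset \ {u})
    have c2 : (d.support.toFinset \ {u}).card = d.length - 1 := by
      rw [Finset.card_sdiff_of_subset (by simp), card_support_isCycle hd, Finset.card_singleton]
    have := card_support_isCycle hc
    have := hd.three_le_length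
    simp only [Walk.length_edges]
    omega
  · refine ⟨c.edges.toFinset ∪ d.edges.toFinset ∪ p.edges.toFinset, ?_, ?_⟩
    · ext e; simp [Walk.edgeSet, or_assoc]
    have huv : u ≠ v := by
      rintro rfl
      exact h1 u c.start_mem_support d.start_mem_support
    have hd1 : Disjoint c.edges.toFinset d.edges.toFinset := by
      rw [List.disjoint_toFinset_iff_disjoint]
      exact disjoint_edges_of_common c d u fun w hw hw' => absurd hw' (h1 w hw)
    have hd2 : Disjoint (c.edges.toFinset ∪ d.edges.toFinset) p.edges.toFinset := by
      rw [Finset.disjoint_union_left, List.disjoint_toFinset_iff_disjoint,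
        List.disjoint_toFinset_iff_disjoint]
      exact ⟨disjoint_edges_of_common c p u h2, disjoint_edges_of_common d p v h3⟩
    rw [Finset.card_union_of_disjoint hd2, Finset.card_union_of_disjoint hd1,
      List.toFinset_card_of_nodup hc.isTrail.edges_nodup,
      List.toFinset_card_of_nodup hd.isTrail.edges_nodup,
      List.toFinset_card_of_nodup hp.isTrail.edges_nodup]
    have hsub : edgeVerts (c.edges.toFinset ∪ d.edges.toFinset ∪ p.edges.toFinset) ⊆
        c.support.toFinset ∪ d.support.toFinset ∪ (p.support.toFinset \ {u, v}) := by
      intro w hw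
      rw [mem_edgeVerts] at hw
      obtain ⟨e, he, hw⟩ := hw
      have hu := c.start_mem_support
      have hv := d.start_mem_support
      simp only [Finset.mem_union, List.mem_toFinset, Finset.mem_sdiff, Finset.mem_insert,
        Finset.mem_singleton] at he ⊢
      have : w ∈ c.support ∨ w ∈ d.support ∨ w ∈ p.support := by
        rcases he with (he | he) | he
        · exact Or.inl (Walk.mem_support_of_mem_edges he hw)
        · exact Or.inr (Or.inl (Walk.mem_support_of_mem_edges he hw))
        · exact Or.inr (Or.inr (Walk.mem_support_of_mem_edges he hw))
      by_cases hwu : w = u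
      · subst hwu; tauto
      by_cases hwv : w = v
      · subst hwv; tauto
      tauto
    have hcard := Finset.card_le_card hsub
    have c1 := Finset.card_union_le (c.support.toFinset ∪ d.support.toFinset)
      (p.support.toFinset \ {u, v})
    have c2 := Finset.card_union_le c.support.toFinset d.support.toFinset
    have c3 : (p.support.toFinset \ {u, v}).card = p.length - 1 := by
      rw [Finset.card_sdiff_of_subset, List.toFinset_card_of_nodup hp.support_nodup,
        Finset.card_pair huv, Walk.length_support]
      · omega
      · intro w hw
        simp only [Finset.mem_insert, Finset.mem_singleton] at hw
        rcases hw with rfl | rfl <;> simp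
    have c5 : 0 < p.length := by
      by_contra h
      exact huv (Walk.eq_of_length_eq_zero (p := p) (by omega))
    have := card_support_isCycle hc
    have := card_support_isCycle hd
    simp only [Walk.length_edges]
    omega

theorem append_common {G : SimpleGraph V} {a b c : V} {p : G.Walk a b} {q : G.Walk b c}
    (h : (p.append q).IsPath) {w : V} (hp : w ∈ p.support) (hq : w ∈ q.support) : w = b := by
  by_contra hne
  exact h.ne_of_mem_support_of_append hne hp hq rfl

/-- A path whose two ends are joined to vertices of the path by two further edges contains a
bicycle. -/
theorem exists_bicycle_of_path {K : SimpleGraph V} {a b x y : V} {p : K.Walk a b} (hp : p.IsPath)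
    (hx : x ∈ p.support) (hy : y ∈ p.support) (hax : K.Adj a x) (hby : K.Adj b y)
    (hxp : s(a, x) ∉ p.edges) (hyp : s(b, y) ∉ p.edges) (hne : s(a, x) ≠ s(b, y)) :
    ∃ C, K.IsBicycleEdgeSet C := by
  obtain ⟨q, r, rfl⟩ := Walk.mem_support_iff_exists_append.1 hx
  have hq := hp.of_append_left
  have hr := hp.of_append_right
  rw [Walk.mem_support_append_iff] at hy
  simp only [Walk.edges_append, List.mem_append, not_or] at hxp hyp
  by_cases hyr : y ∈ r.support
  · obtain ⟨m, t, rfl⟩ := Walk.mem_support_iff_exists_append.1 hyr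
    simp only [Walk.edges_append, List.mem_append, not_or] at hxp hyp
    have hm := hr.of_append_left
    have ht := hr.of_append_right
    have hqm : (q.append m).IsPath := by
      rw [Walk.append_assoc] at hp; exact hp.of_append_left
    have hmt := hr
    have hc : (Walk.cons hax.symm q).IsCycle := by
      rw [Walk.cons_isCycle_iff]; exact ⟨hq, by rw [Sym2.eq_swap]; exact hxp.1⟩
    have hd : (Walk.cons hby.symm t.reverse).IsCycle := by
      rw [Walk.cons_isCycle_iff]
      refine ⟨ht.reverse, ?_⟩
      rw [Sym2.eq_swap, Walk.edges_reverse, List.mem_reverse]; exact hyp.2.2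
    have hcs : ∀ w, w ∈ (Walk.cons hax.symm q).support ↔ w ∈ q.support := by
      intro w
      rw [Walk.support_cons, List.mem_cons]
      refine ⟨?_, Or.inr⟩
      rintro (rfl | h)
      · exact q.end_mem_support
      · exact h
    have hds : ∀ w, w ∈ (Walk.cons hby.symm t.reverse).support ↔ w ∈ t.support := by
      intro w
      rw [Walk.support_cons, List.mem_cons, Walk.support_reverse, List.mem_reverse]
      refine ⟨?_, Or.inr⟩
      rintro (rfl | h)
      · exact t.start_mem_support
      · exact h
    have hqt : ∀ w, w ∈ q.support → w ∈ t.support → w = x ∧ w = y := by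
      intro w hw hw'
      have h1 : w = x := append_common hp hw (by
        rw [Walk.mem_support_append_iff]; exact Or.inr hw')
      refine ⟨h1, append_common hmt ?_ hw'⟩
      rw [h1]; exact m.start_mem_support
    by_cases hxy : x = y
    · subst hxy
      refine ⟨_, Or.inr (Or.inl ⟨x, _, _, hc, hd, ?_, rfl⟩)⟩
      intro w hw hw'
      exact (hqt w ((hcs w).1 hw) ((hds w).1 hw')).1
    · refine ⟨_, Or.inr (Or.inr ⟨x, y, _, _, m, hc, hd, hm, ?_, ?_, ?_, rfl⟩)⟩
      · intro w hw hw'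
        obtain ⟨h1, h2⟩ := hqt w ((hcs w).1 hw) ((hds w).1 hw')
        exact hxy (h1.symm.trans h2)
      · intro w hw hw'
        exact append_common hqm ((hcs w).1 hw) hw'
      · intro w hw hw'
        exact append_common hmt hw' ((hds w).1 hw)
  · have hyq := hy.resolve_right hyr
    obtain ⟨l, m, rfl⟩ := Walk.mem_support_iff_exists_append.1 hyq
    simp only [Walk.edges_append, List.mem_append, not_or] at hxp hyp
    have hm := hq.of_append_right
    have hl := hq.of_append_left
    have hyx : y ≠ x := by
      rintro rfl; exact hyr r.start_mem_support
    have hmr : (m.append r).IsPath := by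
      rw [← Walk.append_assoc] at hp; exact hp.of_append_right
    have hlr : ∀ w, w ∈ l.support → w ∉ r.support := by
      intro w hw hw'
      have h1 : w = x := append_common hp (by
        rw [Walk.mem_support_append_iff]; exact Or.inl hw) hw'
      have h2 : w = y := append_common hq hw (by rw [h1]; exact m.end_mem_support)
      exact hyx (h2.symm.trans h1)
    have hxl : x ∉ l.support := fun h => hlr x h r.start_mem_support
    -- the two outer paths from `y` to `x`
    have h2 : (l.reverse.concat hax).IsPath := by
      refine hl.reverse.concat ?_ hax
      rw [Walk.support_reverse, List.mem_reverse]; exact hxl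
    have h3 : (Walk.cons hby.symm r.reverse).IsPath := by
      rw [Walk.cons_isPath_iff]
      refine ⟨hr.reverse, ?_⟩
      rw [Walk.support_reverse, List.mem_reverse]; exact hyr
    have hs2 : ∀ w, w ∈ (l.reverse.concat hax).support ↔ w ∈ l.support ∨ w = x := by
      intro w; simp [Walk.support_concat]
    have hs3 : ∀ w, w ∈ (Walk.cons hby.symm r.reverse).support ↔ w = y ∨ w ∈ r.support := by
      intro w; simp
    have he2 : ∀ e, e ∈ (l.reverse.concat hax).edgeSet ↔ e ∈ l.edges ∨ e = s(a, x) := by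
      intro e
      change e ∈ (l.reverse.concat hax).edges ↔ _
      simp [Walk.edges_concat]
    have he3 : ∀ e, e ∈ (Walk.cons hby.symm r.reverse).edgeSet ↔ e = s(b, y) ∨ e ∈ r.edges := by
      intro e
      change e ∈ (Walk.cons hby.symm r.reverse).edges ↔ _
      simp [Sym2.eq_swap]
    have hlm : l.edges.Disjoint m.edges :=
      disjoint_edges_of_common l m y fun w hw hw' => append_common hq hw hw'
    have hmr' : m.edges.Disjoint r.edges :=
      disjoint_edges_of_common m r x fun w hw hw' => append_common hmr hw hw'
    have hlr' : l.edges.Disjoint r.edges :=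
      disjoint_edges_of_common l r x fun w hw hw' => absurd hw' (hlr w hw)
    refine ⟨_, Or.inl ⟨y, x, m, l.reverse.concat hax, Walk.cons hby.symm r.reverse, hyx, hm, h2,
      h3, ?_, ?_, ?_, ?_, ?_, ?_, rfl⟩⟩
    · intro w hw hw'
      rcases (hs2 w).1 hw' with h | h
      · exact Or.inl (append_common hq h hw)
      · exact Or.inr h
    · intro w hw hw'
      rcases (hs3 w).1 hw' with h | h
      · exact Or.inl h
      · exact Or.inr (append_common hmr hw h)
    · intro w hw hw'
      rcases (hs2 w).1 hw with h | h
      · rcases (hs3 w).1 hw' with h' | h'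
        · exact Or.inl h'
        · exact absurd h' (hlr w h)
      · exact Or.inr h
    · rw [Set.disjoint_left]
      intro e he he'
      rcases (he2 e).1 he' with h | rfl
      · exact hlm h he
      · exact hxp.1.2 he
    · rw [Set.disjoint_left]
      intro e he he'
      rcases (he3 e).1 he' with rfl | h
      · exact hyp.1.2 he
      · exact hmr' he h
    · rw [Set.disjoint_left]
      intro e he he'
      rcases (he2 e).1 he with h | rfl
      · rcases (he3 e).1 he' with rfl | h'
        · exact hyp.1.1 h
        · exact hlr' h h'
      · rcases (he3 _).1 he' with h' | h'
        · exact hne h'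
        · exact hxp.2 h'

theorem exists_bicycle_subset [Finite V] (G : SimpleGraph V) (A : Finset (Sym2 V))
    (hA : (A : Set (Sym2 V)) ⊆ G.edgeSet) (hcard : (edgeVerts A).card < A.card) :
    ∃ C, G.IsBicycleEdgeSet C ∧ C ⊆ A := by
  classical
  induction A using Finset.strongInduction with
  | H A ih =>
  by_cases hmin : ∃ B, B ⊂ A ∧ (edgeVerts B).card < B.card
  · obtain ⟨B, hBA, hB⟩ := hmin
    have hBA' : (B : Set (Sym2 V)) ⊆ A := by exact_mod_cast hBA.1
    obtain ⟨C, hC, hCB⟩ := ih B hBA (hBA'.trans hA) hB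
    exact ⟨C, hC, hCB.trans hBA'⟩
  push Not at hmin
  -- work in the graph with edge set `A`
  obtain ⟨K, hK⟩ : ∃ K : SimpleGraph V, K = fromEdgeSet (A : Set (Sym2 V)) := ⟨_, rfl⟩
  have hKe : K.edgeSet = A := by rw [hK]; exact edgeSet_fromEdgeSet_of_subset hA
  have hKG : K ≤ G := by rw [← edgeSet_subset_edgeSet, hKe]; exact hA
  have hmemA : ∀ {x y}, K.Adj x y → s(x, y) ∈ A := by
    intro x y h
    have : s(x, y) ∈ K.edgeSet := h
    rw [hKe] at this
    exact_mod_cast this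
  have hofA : ∀ {x y}, s(x, y) ∈ A → K.Adj x y := by
    intro x y h
    have : s(x, y) ∈ K.edgeSet := by rw [hKe]; exact_mod_cast h
    exact this
  suffices h : ∃ C, K.IsBicycleEdgeSet C by
    obtain ⟨C, hC⟩ := h
    refine ⟨C, hC.mono hKG, ?_⟩
    intro e he
    rw [← hKe]
    rcases hC with ⟨u, v, p, q, r, -, -, -, -, -, -, -, -, -, -, rfl⟩ |
      ⟨u, c, d, -, -, -, rfl⟩ | ⟨u, v, c, d, p, -, -, -, -, -, -, rfl⟩
    · rcases he with (he | he) | he <;> exact Walk.edges_subset_edgeSet _ he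
    · rcases he with he | he <;> exact Walk.edges_subset_edgeSet _ he
    · rcases he with (he | he) | he <;> exact Walk.edges_subset_edgeSet _ he
  have hdeg : ∀ a x, K.Adj a x → ∃ y, y ≠ x ∧ K.Adj a y := by
    intro a x hax
    by_contra! hcon
    have h1 := hmin _ (Finset.erase_ssubset (hmemA hax))
    rw [Finset.card_erase_of_mem (hmemA hax)] at h1
    have h2 : edgeVerts (A.erase s(a, x)) ⊆ (edgeVerts A).erase a := by
      intro v hv
      rw [Finset.mem_erase]
      refine ⟨?_, edgeVerts_mono (Finset.erase_subset _ _) hv⟩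
      rintro rfl
      rw [mem_edgeVerts] at hv
      obtain ⟨e, he, hve⟩ := hv
      rw [Finset.mem_erase] at he
      obtain ⟨y, rfl⟩ := Sym2.mem_iff_exists.1 hve
      by_cases hyx : y = x
      · subst hyx; exact he.1 rfl
      · exact hcon y hyx (hofA he.2)
    have h3 := Finset.card_le_card h2
    have ha : a ∈ edgeVerts A := mem_edgeVerts.2 ⟨_, hmemA hax, by simp⟩
    rw [Finset.card_erase_of_mem ha] at h3
    have h4 : 0 < (edgeVerts A).card := Finset.card_pos.2 ⟨a, ha⟩
    omega
  have hAne : A.Nonempty := Finset.card_pos.1 (by omega)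
  obtain ⟨e₀, he₀⟩ := hAne
  obtain ⟨a₀, b₀, hab₀⟩ : ∃ a b, K.Adj a b := by
    induction e₀ with
    | _ x y => exact ⟨x, y, hofA he₀⟩
  have : Nonempty V := ⟨a₀⟩
  obtain ⟨a, b, p, hp, hmax⟩ := Walk.exists_isPath_forall_isPath_length_le_length K
  have hlen : 1 ≤ p.length := by
    have := hmax a₀ b₀ (Walk.cons hab₀ Walk.nil) (by simp [hab₀.ne])
    simpa using this
  -- in a longest path, every end has a further edge back to the path
  have hend : ∀ {c d : V} (s : K.Walk c d), s.IsPath → s.length = p.length →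
      ∀ z, K.Adj c z → z ∈ s.support := by
    intro c d s hs hsl z hz
    by_contra h
    have := hmax z d (Walk.cons hz.symm s) (by rw [Walk.cons_isPath_iff]; exact ⟨hs, h⟩)
    rw [Walk.length_cons] at this
    omega
  have hback : ∀ {c d : V} (s : K.Walk c d), s.IsPath → s.length = p.length →
      ∃ z, K.Adj c z ∧ s(c, z) ∉ s.edges := by
    intro c d s hs hsl
    cases s with
    | nil => simp at hsl; omega
    | @cons _ w _ hcw s' =>
      obtain ⟨z, hzw, hz⟩ := hdeg c w hcw
      refine ⟨z, hz, ?_⟩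
      rw [Walk.cons_isPath_iff] at hs
      rw [Walk.edges_cons, List.mem_cons, not_or]
      refine ⟨?_, fun h => hs.2 (Walk.fst_mem_support_of_mem_edges _ h)⟩
      intro h
      exact hzw (Sym2.congr_right.1 h)
  have hmain : ∀ {c d : V} (s : K.Walk c d), s.IsPath → s.length = p.length →
      ∀ z, K.Adj c z → s(c, z) ∉ s.edges → z ≠ d → ∃ C, K.IsBicycleEdgeSet C := by
    intro c d s hs hsl z hz hzs hzd
    have hrl : s.reverse.length = p.length := by rw [Walk.length_reverse, hsl]
    obtain ⟨y, hy, hys⟩ := hback s.reverse hs.reverse hrl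
    have hy' := hend s.reverse hs.reverse hrl y hy
    rw [Walk.edges_reverse, List.mem_reverse] at hys
    rw [Walk.support_reverse, List.mem_reverse] at hy'
    refine exists_bicycle_of_path hs (hend s hs hsl z hz) hy' hz hy hzs hys ?_
    intro h
    rw [Sym2.eq_iff] at h
    rcases h with ⟨h1, -⟩ | ⟨-, h2⟩
    · subst h1
      rw [Walk.isPath_iff_nil, ← Walk.length_eq_zero_iff] at hs
      omega
    · exact hzd h2
  obtain ⟨x, hax, hxp⟩ := hback p hp rfl
  by_cases hxb : x ≠ b
  · exact hmain p hp rfl x hax hxp hxb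
  push Not at hxb
  subst hxb
  -- the path closes up to a cycle with edge set `S`
  let S : Finset (Sym2 V) := insert s(a, x) p.edges.toFinset
  have hSA : S ⊆ A := by
    intro e he
    rw [Finset.mem_insert, List.mem_toFinset] at he
    rcases he with rfl | he
    · exact hmemA hax
    · have := p.edges_subset_edgeSet he
      rw [hKe] at this
      exact_mod_cast this
  have hScard : S.card = p.length + 1 := by
    rw [Finset.card_insert_of_notMem (by simpa using hxp),
      List.toFinset_card_of_nodup hp.isTrail.edges_nodup, Walk.length_edges]
  obtain ⟨s, t, hst, hstS, hsp⟩ : ∃ s t, K.Adj s t ∧ s(s, t) ∉ S ∧ s ∈ p.support := by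
    by_contra! hcon
    have h1 : (A \ S).card ≤ (edgeVerts (A \ S)).card := by
      refine hmin _ (Finset.sdiff_ssubset hSA ⟨s(a, x), Finset.mem_insert_self _ _⟩)
    rw [Finset.card_sdiff_of_subset hSA, hScard] at h1
    have hdisj : Disjoint (edgeVerts (A \ S)) p.support.toFinset := by
      rw [Finset.disjoint_left]
      intro v hv hv'
      rw [List.mem_toFinset] at hv'
      obtain ⟨e, he, hve⟩ := mem_edgeVerts.1 hv
      obtain ⟨y, rfl⟩ := Sym2.mem_iff_exists.1 hve
      rw [Finset.mem_sdiff] at he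
      exact hcon v y (hofA he.1) he.2 hv'
    have hsub : edgeVerts (A \ S) ∪ p.support.toFinset ⊆ edgeVerts A := by
      refine Finset.union_subset (edgeVerts_mono Finset.sdiff_subset) ?_
      intro v hv
      rw [List.mem_toFinset, Walk.mem_support_iff_exists_mem_edges_of_not_nil] at hv
      · obtain ⟨e, he, hve⟩ := hv
        exact mem_edgeVerts.2 ⟨e, hSA (by simp [S, he]), hve⟩
      · rw [← Walk.length_eq_zero_iff]; omega
    have h2 := Finset.card_le_card hsub
    rw [Finset.card_union_of_disjoint hdisj, List.toFinset_card_of_nodup hp.support_nodup,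
      Walk.length_support] at h2
    have h3 := Finset.card_le_card hSA
    omega
  obtain ⟨q, r, hpqr⟩ := Walk.mem_support_iff_exists_append.1 hsp
  have hnot : s(s, t) ≠ s(a, x) ∧ s(s, t) ∉ p.edges := by
    simpa [S] using hstS
  cases q with
  | nil =>
    refine hmain p hp rfl t hst hnot.2 ?_
    rintro rfl
    exact hnot.1 rfl
  | cons h q₀ =>
    obtain ⟨s', q', h', heq⟩ := Walk.exists_cons_eq_concat h q₀
    rw [heq] at hpqr
    have hsup : p.support = q'.support ++ r.support := by
      rw [hpqr, Walk.support_append, Walk.support_concat,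
        List.append_assoc, List.singleton_append, Walk.cons_tail_support]
    have hedg : ∀ e, e ∈ p.edges ↔ e ∈ q'.edges ∨ e = s(s', s) ∨ e ∈ r.edges := by
      intro e
      rw [hpqr, Walk.edges_append, Walk.edges_concat]
      simp
    have hrot : (r.append (Walk.cons hax.symm q')).IsPath := by
      rw [Walk.isPath_def, Walk.support_append, Walk.support_cons, List.tail_cons,
        List.nodup_append_comm, ← hsup]
      exact hp.support_nodup
    refine hmain _ hrot ?_ t hst ?_ ?_
    · rw [hpqr, Walk.length_append, Walk.length_append, Walk.length_cons, Walk.length_concat]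
      omega
    · rw [Walk.edges_append, Walk.edges_cons, List.mem_append, List.mem_cons]
      rintro (h1 | h1 | h1)
      · exact hnot.2 ((hedg _).2 (Or.inr (Or.inr h1)))
      · exact hnot.1 (h1.trans Sym2.eq_swap)
      · exact hnot.2 ((hedg _).2 (Or.inl h1))
    · rintro rfl
      exact hnot.2 ((hedg _).2 (Or.inr (Or.inl Sym2.eq_swap)))

theorem isBicycleFree_iff [Finite V] {G : SimpleGraph V} {I : Set (Sym2 V)} :
    G.IsBicycleFree I ↔ I ⊆ G.edgeSet ∧ IsSparse I := by
  refine and_congr_right fun hI => ⟨fun h A hA => ?_, fun h C hC hCI => ?_⟩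
  · by_contra hlt
    obtain ⟨C, hC, hCA⟩ := G.exists_bicycle_subset A (hA.trans hI) (by omega)
    exact h C hC (hCA.trans hA)
  · obtain ⟨A, rfl, hA⟩ := hC.exists_finset
    have := h A hCI
    omega

/-- The bicircular matroid `B(G)` of a finite graph `G`: its ground set is the edge set of `G`, and
a set of edges is independent when it contains no bicycle, so that the circuits are the
bicycles. -/
def bicircularMatroid [Finite V] (G : SimpleGraph V) : Matroid (Sym2 V) :=
  IndepMatroid.matroid <| IndepMatroid.ofFinite (E := G.edgeSet) (Set.toFinite _) G.IsBicycleFree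
    (isBicycleFree_iff.2 ⟨Set.empty_subset _, fun A hA => by
      have : A = ∅ := by exact_mod_cast Set.subset_empty_iff.1 hA
      simp [this]⟩)
    (fun _ _ hJ hIJ => ⟨hIJ.trans hJ.1, fun C hC h => hJ.2 C hC (h.trans hIJ)⟩)
    (fun I J hI hJ hIJ => by
      rw [isBicycleFree_iff] at hI hJ
      obtain ⟨e, heJ, heI, he⟩ := isSparse_aug hI.2 hJ.2 hIJ
      exact ⟨e, heJ, heI, isBicycleFree_iff.2 ⟨Set.insert_subset (hJ.1 heJ) hI.1, he⟩⟩)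
    (fun _ hI => hI.1)

end SimpleGraph

/-! ### The fixing number of a matroid -/

namespace Matroid

variable {α : Type*}

/-- A bijection of the ground set is an automorphism of `M` if it preserves the circuits. -/
def IsAutomorphism (M : Matroid α) (φ : Equiv.Perm M.E) : Prop :=
  ∀ C : Set M.E, M.IsCircuit (Subtype.val '' (φ '' C)) ↔ M.IsCircuit (Subtype.val '' C)

/-- `S` is a fixing set of `M` if the only automorphism that fixes `S` pointwise is the
identity. -/
def IsFixingSet (M : Matroid α) (S : Finset M.E) : Prop :=
  ∀ φ : Equiv.Perm M.E, M.IsAutomorphism φ → (∀ x ∈ S, φ x = x) → φ = 1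

/-- The fixing number: the minimum size of a fixing set. For a finite ground set the minimum is
over a non-empty set of sizes, since the ground set itself is a fixing set. -/
noncomputable def fixingNumber (M : Matroid α) : ℕ :=
  sInf {r | ∃ S : Finset M.E, S.card = r ∧ M.IsFixingSet S}

end Matroid

/-! ### Fixing numbers and automorphisms of a matroid -/

namespace Matroid

variable {α : Type*}

/-! Lower bound, for n ≥ 3. Both matroids are invariant under permutations of the vertices, so a
transposition (u v) induces an automorphism, and it is not the identity because a third vertex w
gives an edge uw that moves. A fixing set S therefore contains, for all u ≠ v, an edge with exactly
one end in {u, v}. As a graph, S then has at most one isolated vertex and no component that is a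
single edge; a weighted degree count gives 2n ≤ 3|S| + 2, that is |S| ≥ ⌊2n/3⌋
(`two_mul_card_le_of_separating`, `two_mul_card_le_of_isFixingSet`).

Upper bound. The only property of automorphisms that is needed is that they map triangles to
triangles. In M(K_n) the triangles are the circuits with three elements. In B(K_n) with n ≥ 5 the
copies of K_4 are the six-element sets all of whose five-element subsets are circuits, and a
triangle is the intersection of two copies of K_4. If a triangle-preserving permutation fixes two
adjacent edges, it fixes the triangle that they span, and every edge at a vertex of this triangle
keeps that vertex. Hence it fixes all edges once such paths cover all vertices but at most one
(`PreservesTriangles.apply_eq`). This is achieved by ⌊n/3⌋ disjoint paths of two edges, with one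
more edge attached when n ≡ 2 mod 3: ⌊2n/3⌋ edges in all (`fixingNumber_le_of_preservesTriangles`).

Exceptions. The circuits of B(K_4) are all the five-element sets of its six edges, so every
permutation is an automorphism and five edges must be fixed. For the remaining small n, leaving out
one edge already gives the upper bound. -/

theorem IsFixingSet.fixingNumber_le {M : Matroid α} {S : Finset M.E} (h : M.IsFixingSet S) :
    M.fixingNumber ≤ S.card :=
  Nat.sInf_le ⟨S, rfl, h⟩

theorem le_fixingNumber {M : Matroid α} [Finite M.E] {k : ℕ}
    (h : ∀ S : Finset M.E, M.IsFixingSet S → k ≤ S.card) : k ≤ M.fixingNumber := by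
  have := Fintype.ofFinite M.E
  -- Finiteness provides a fixing set, namely the whole ground set; without one the infimum would
  -- take its default value 0.
  refine le_csInf ⟨_, Finset.univ, rfl, fun φ _ hφ => Equiv.ext fun x => hφ x (by simp)⟩ ?_
  rintro _ ⟨S, rfl, hS⟩
  exact h S hS

/-- A set that misses at most one element of the ground set is a fixing set. -/
theorem isFixingSet_of_forall_notMem_eq {M : Matroid α} {S : Finset M.E}
    (h : ∀ x y, x ∉ S → y ∉ S → x = y) : M.IsFixingSet S := by
  intro φ _ hφ
  ext1 x
  by_cases hx : x ∈ S
  · exact hφ x hx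
  -- If `φ x` were in `S`, it would be fixed, and injectivity would give `φ x = x`. So `x` and `φ x`
  -- are both missed by `S`.
  · refine h _ _ (fun hx' => hx ?_) hx
    rwa [← φ.injective (hφ _ hx')]

theorem fixingNumber_le_natCard_sub_one {M : Matroid α} [Finite M.E] :
    M.fixingNumber ≤ Nat.card M.E - 1 := by
  classical
  have := Fintype.ofFinite M.E
  rw [Nat.card_eq_fintype_card]
  rcases isEmpty_or_nonempty M.E with hE | ⟨⟨x⟩⟩
  · exact (isFixingSet_of_forall_notMem_eq (S := ∅) fun x => isEmptyElim x).fixingNumber_le.trans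
      (by simp)
  · refine (isFixingSet_of_forall_notMem_eq (S := Finset.univ.erase x) ?_).fixingNumber_le.trans ?_
    · intro y z hy hz
      simp only [Finset.mem_erase, Finset.mem_univ, and_true, not_not] at hy hz
      rw [hy, hz]
    · rw [Finset.card_erase_of_mem (Finset.mem_univ x), Finset.card_univ]

/-- If a set misses two elements, the transposition of these two is a nontrivial automorphism that
fixes the set pointwise. -/
theorem fixingNumber_eq_natCard_sub_one {M : Matroid α} [Finite M.E]
    (h : ∀ φ : Equiv.Perm M.E, M.IsAutomorphism φ) : M.fixingNumber = Nat.card M.E - 1 := by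
  classical
  refine le_antisymm fixingNumber_le_natCard_sub_one (le_fixingNumber fun S hS => ?_)
  have := Fintype.ofFinite M.E
  rw [Nat.card_eq_fintype_card]
  by_contra hlt
  have hc : 1 < Sᶜ.card := by rw [Finset.card_compl]; omega
  obtain ⟨x, hx, y, hy, hxy⟩ := Finset.one_lt_card.1 hc
  rw [Finset.mem_compl] at hx hy
  have h1 := hS (Equiv.swap x y) (h _) fun z hz =>
    Equiv.swap_apply_of_ne_of_ne (fun e => hx (e ▸ hz)) (fun e => hy (e ▸ hz))
  have h2 := Equiv.swap_apply_left x y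
  rw [h1] at h2
  exact hxy h2

/-- Circuits are the minimal dependent sets, and a bijection respects inclusion. -/
theorem isCircuit_image_iff {M : Matroid α} {σ : Equiv.Perm α}
    (h : ∀ X, M.Dep (σ '' X) ↔ M.Dep X) (C : Set α) :
    M.IsCircuit (σ '' C) ↔ M.IsCircuit C := by
  rw [isCircuit_iff, isCircuit_iff, h]
  refine and_congr_right fun _ => ⟨fun hC D hD hDC => ?_, fun hC D hD hDC => ?_⟩
  · exact σ.injective.image_injective (hC ((h D).2 hD) (Set.image_mono hDC))
  · obtain ⟨D, rfl⟩ := σ.surjective.image_surjective D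
    rw [hC ((h D).1 hD) ((Set.image_subset_image_iff σ.injective).1 hDC)]

/-- Automorphisms live on the subtype of the ground set and speak of circuits; this produces them
from permutations of the ambient type, with a condition on independent sets only. -/
theorem isAutomorphism_subtypePerm {M : Matroid α} {σ : Equiv.Perm α}
    (hE : ∀ x, σ x ∈ M.E ↔ x ∈ M.E) (h : ∀ I, M.Indep (σ '' I) ↔ M.Indep I) :
    M.IsAutomorphism (σ.subtypePerm hE) := by
  intro C
  have h1 : Subtype.val '' (σ.subtypePerm hE '' C) = σ '' (Subtype.val '' C) := by
    rw [Set.image_image, Set.image_image]; rfl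
  rw [h1]
  refine isCircuit_image_iff (fun X => ?_) _
  have h2 : σ '' X ⊆ M.E ↔ X ⊆ M.E := by
    rw [Set.image_subset_iff]
    exact forall₂_congr fun x _ => hE x
  simp only [Dep, h, h2]

/-- Extension by the identity outside the ground set; later arguments about edges can then be
carried out in `Sym2 V` without subtypes. -/
theorem IsAutomorphism.exists_perm {M : Matroid α} {φ : Equiv.Perm M.E}
    (h : M.IsAutomorphism φ) : ∃ ψ : Equiv.Perm α, (∀ x : M.E, ψ x = φ x) ∧
      ∀ C, M.IsCircuit C → M.IsCircuit (ψ '' C) := by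
  classical
  refine ⟨Equiv.Perm.ofSubtype φ, Equiv.Perm.ofSubtype_apply_coe φ, fun C hC => ?_⟩
  have h1 : C = Subtype.val '' (Subtype.val ⁻¹' C : Set M.E) := by
    rw [Subtype.image_preimage_coe, Set.inter_eq_right.2 hC.subset_ground]
  rw [h1] at hC ⊢
  rw [← h] at hC
  convert hC using 1
  rw [Set.image_image, Set.image_image]
  exact Set.image_congr fun x _ => Equiv.Perm.ofSubtype_apply_coe φ x

end Matroid

namespace SimpleGraph

variable {V : Type*}

/-! ### Separating sets of edges -/

/-- If a set of edges of a complete graph contains, for any two vertices, an edge that is incident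
with exactly one of them, then it has at least `(2 * n - 2) / 3` elements. -/
theorem two_mul_card_le_of_separating [Fintype V] {S : Finset (Sym2 V)}
    (hS : ∀ e ∈ S, ¬ e.IsDiag) (h : ∀ u v : V, u ≠ v → ∃ e ∈ S, ¬ (u ∈ e ↔ v ∈ e)) :
    2 * Fintype.card V ≤ 3 * S.card + 2 := by
  classical
  let d : V → ℕ := fun v => (S.filter (v ∈ ·)).card
  -- Vertices of degree 1 get weight 2, so that degree times weight is at least 2 at every vertex
  -- that is not isolated.
  let w : V → ℕ := fun v => if d v = 1 then 2 else 1
  have hd : ∀ e ∈ S, ∀ v ∈ e, 0 < d v := fun e he v hv =>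
    Finset.card_pos.2 ⟨e, Finset.mem_filter.2 ⟨he, hv⟩⟩
  have hd2 : ∀ e ∈ S, ∀ f ∈ S, e ≠ f → ∀ v ∈ e, v ∈ f → 1 < d v :=
    fun e he f hf hef v hve hvf => Finset.one_lt_card.2
      ⟨e, Finset.mem_filter.2 ⟨he, hve⟩, f, Finset.mem_filter.2 ⟨hf, hvf⟩, hef⟩
  -- Double counting: each edge contributes the sum of the weights of its ends. This is at most 3,
  -- because two ends of degree 1 would be separated by no edge of `S`.
  have h1 : ∑ v, d v * w v ≤ 3 * S.card := by
    have : ∑ v, d v * w v = ∑ e ∈ S, ∑ v ∈ e.toFinset, w v := by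
      have h2 : ∀ v, d v * w v = ∑ e ∈ S, if v ∈ e then w v else 0 := by
        intro v
        rw [← Finset.sum_filter, Finset.sum_const, smul_eq_mul]
      simp_rw [h2]
      rw [Finset.sum_comm]
      refine Finset.sum_congr rfl fun e _ => ?_
      rw [← Finset.sum_filter]
      refine Finset.sum_congr ?_ fun _ _ => rfl
      ext v; simp
    rw [this, mul_comm, ← smul_eq_mul]
    refine Finset.sum_le_card_nsmul _ _ _ fun e he => ?_
    induction e with
    | _ u v =>
      have huv : u ≠ v := fun e => hS _ he (by simp [e])
      rw [Sym2.toFinset_mk_eq, Finset.sum_pair huv]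
      obtain ⟨f, hf, hfuv⟩ := h u v huv
      have hne : s(u, v) ≠ f := by rintro rfl; simp at hfuv
      have : 1 < d u ∨ 1 < d v := by
        by_cases hu : u ∈ f
        · exact Or.inl (hd2 _ he f hf hne u (by simp) hu)
        · exact Or.inr (hd2 _ he f hf hne v (by simp) (by tauto))
      simp only [w]
      split_ifs <;> omega
  -- Two isolated vertices would not be separated either.
  have h2 : (Finset.univ.filter fun v => d v = 0).card ≤ 1 := by
    rw [Finset.card_le_one]
    intro u hu v hv
    by_contra huv
    obtain ⟨e, he, heuv⟩ := h u v huv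
    have h3 := hd e he u
    have h4 := hd e he v
    rw [Finset.mem_filter] at hu hv
    have : u ∈ e ∨ v ∈ e := by tauto
    rcases this with h5 | h5
    · have := h3 h5; omega
    · have := h4 h5; omega
  have h3 : (Finset.univ.filter fun v => d v ≠ 0).card * 2 ≤ ∑ v, d v * w v := by
    refine le_trans ?_ (Finset.sum_le_sum_of_subset (Finset.subset_univ
      (Finset.univ.filter fun v => d v ≠ 0)))
    rw [← smul_eq_mul]
    refine Finset.card_nsmul_le_sum _ _ _ fun v hv => ?_
    rw [Finset.mem_filter] at hv
    by_cases h4 : d v = 1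
    · simp [w, h4]
    · simp only [w, if_neg h4]; omega
  have h4 := Finset.card_filter_add_card_filter_not (s := (Finset.univ : Finset V))
    (fun v => d v = 0)
  rw [Finset.card_univ] at h4
  simp only [ne_eq] at h3
  omega

/-! ### Transpositions of vertices and the lower bound -/

/-- An edge with both ends in {u, v} has its ends exchanged, and one that avoids both vertices is
untouched. So the transposition moves only edges that separate `u` from `v`. -/
theorem sym2_map_swap_eq [DecidableEq V] {u v : V} {e : Sym2 V} (he : ¬ e.IsDiag)
    (h : u ∈ e ↔ v ∈ e) :
    Sym2.map (Equiv.swap u v) e = e := by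
  induction e with
  | _ x y =>
    simp only [Sym2.mem_iff, Sym2.mk_isDiag_iff, Sym2.map_mk, Sym2.eq_iff, Equiv.swap_apply_def] at *
    split_ifs <;> grind

theorem mem_completeGraph_edgeSet {e : Sym2 V} : e ∈ (completeGraph V).edgeSet ↔ ¬ e.IsDiag := by
  induction e with
  | _ x y => simp [completeGraph]

/-- The lower bound for a matroid on the edges of a complete graph that is invariant under the
permutations of the vertices. -/
theorem two_mul_card_le_of_isFixingSet [Fintype V] {M : Matroid (Sym2 V)}
    (hV : 3 ≤ Fintype.card V) (hE : M.E = (completeGraph V).edgeSet)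
    (h : ∀ (σ : Equiv.Perm V) (I : Set (Sym2 V)), M.Indep I → M.Indep (Sym2.map σ '' I))
    {S : Finset M.E} (hS : M.IsFixingSet S) : 2 * Fintype.card V ≤ 3 * S.card + 2 := by
  classical
  have hE' : ∀ e : Sym2 V, e ∈ M.E ↔ ¬ e.IsDiag := fun e => by
    rw [hE, mem_completeGraph_edgeSet]
  rw [← Finset.card_map (Function.Embedding.subtype _)]
  refine two_mul_card_le_of_separating ?_ ?_
  · intro e he
    obtain ⟨e, -, rfl⟩ := Finset.mem_map.1 he
    exact (hE' _).1 e.2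
  intro u v huv
  by_contra! hcon
  let σ : Equiv.Perm V := Equiv.swap u v
  have hinv : ∀ e : Sym2 V, Sym2.map σ (Sym2.map σ e) = e := by
    intro e
    induction e with
    | _ x y => simp [σ]
  let τ : Equiv.Perm (Sym2 V) := ⟨Sym2.map σ, Sym2.map σ, hinv, hinv⟩
  have hτE : ∀ e, τ e ∈ M.E ↔ e ∈ M.E := by
    intro e
    rw [hE', hE']
    exact not_congr (Sym2.isDiag_map σ.injective)
  have hτ : ∀ I, M.Indep (τ '' I) ↔ M.Indep I := by
    refine fun I => ⟨fun hI => ?_, h σ I⟩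
    have := h σ _ hI
    rw [Set.image_image] at this
    change M.Indep ((fun e => Sym2.map σ (Sym2.map σ e)) '' I) at this
    simpa only [hinv, Set.image_id'] using this
  have h1 := hS _ (M.isAutomorphism_subtypePerm hτE hτ) fun e he => by
    apply Subtype.ext
    exact sym2_map_swap_eq ((hE' _).1 e.2)
      (hcon e (Finset.mem_map.2 ⟨e, he, rfl⟩))
  -- The third vertex shows that the induced automorphism is not the identity: it sends the edge uw
  -- to vw.
  obtain ⟨w, hwu, hwv⟩ : ∃ w, w ≠ u ∧ w ≠ v := by
    have : (({u, v} : Finset V)ᶜ).Nonempty := by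
      rw [← Finset.card_pos, Finset.card_compl]
      have := Finset.card_le_two (a := u) (b := v)
      omega
    obtain ⟨w, hw⟩ := this
    exact ⟨w, by simpa using hw⟩
  have huw : s(u, w) ∈ M.E := (hE' _).2 (by simpa using hwu.symm)
  have h2 : τ s(u, w) = s(u, w) := congrArg Subtype.val (Equiv.ext_iff.1 h1 ⟨_, huw⟩)
  change s(σ u, σ w) = _ at h2
  simp only [σ, Equiv.swap_apply_left, Equiv.swap_apply_of_ne_of_ne hwu hwv] at h2
  exact huv (Sym2.congr_left.1 h2).symm

/-! ### Edge sets of complete subgraphs -/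

open Classical in
/-- The edges of the complete graph on `A`. -/
noncomputable def cliqueEdges (A : Finset V) : Finset (Sym2 V) :=
  A.sym2.filter fun e => ¬ e.IsDiag

theorem mem_cliqueEdges {A : Finset V} {e : Sym2 V} :
    e ∈ cliqueEdges A ↔ ¬ e.IsDiag ∧ ∀ v ∈ e, v ∈ A := by
  classical
  rw [cliqueEdges, Finset.mem_filter, Finset.mem_sym2_iff, and_comm]

theorem mk_mem_cliqueEdges {A : Finset V} {x y : V} :
    s(x, y) ∈ cliqueEdges A ↔ x ≠ y ∧ x ∈ A ∧ y ∈ A := by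
  simp [mem_cliqueEdges]

theorem card_cliqueEdges (A : Finset V) : (cliqueEdges A).card = A.card.choose 2 := by
  classical
  rw [← Sym2.card_image_offDiag]
  congr 1
  ext e
  induction e with
  | _ x y =>
    rw [mk_mem_cliqueEdges, Finset.mem_image]
    constructor
    · rintro ⟨h, hx, hy⟩
      exact ⟨(x, y), Finset.mem_offDiag.2 ⟨hx, hy, h⟩, rfl⟩
    · rintro ⟨⟨a, b⟩, hab, h⟩
      rw [Finset.mem_offDiag] at hab
      rcases Sym2.eq_iff.1 h with ⟨rfl, rfl⟩ | ⟨rfl, rfl⟩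
      · exact ⟨hab.2.2, hab.1, hab.2.1⟩
      · exact ⟨hab.2.2.symm, hab.2.1, hab.1⟩

theorem cliqueEdges_inter [DecidableEq V] (A B : Finset V) :
    cliqueEdges A ∩ cliqueEdges B = cliqueEdges (A ∩ B) := by
  ext e
  simp only [Finset.mem_inter, mem_cliqueEdges]
  grind

theorem edgeVerts_subset_iff {S : Finset (Sym2 V)} {A : Finset V} (hS : ∀ e ∈ S, ¬ e.IsDiag) :
    edgeVerts S ⊆ A ↔ S ⊆ cliqueEdges A := by
  constructor
  · exact fun h e he => mem_cliqueEdges.2 ⟨hS e he, fun v hv => h (mem_edgeVerts.2 ⟨e, he, hv⟩)⟩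
  · intro h v hv
    obtain ⟨e, he, hv⟩ := mem_edgeVerts.1 hv
    exact (mem_cliqueEdges.1 (h he)).2 v hv

/-! ### Permutations of the edges that preserve triangles -/

/-- A permutation of the edges of a complete graph maps triangles to triangles. -/
def PreservesTriangles (ψ : Equiv.Perm (Sym2 V)) : Prop :=
  ∀ A : Finset V, A.card = 3 →
    ∃ B : Finset V, B.card = 3 ∧ (cliqueEdges A).map ψ.toEmbedding = cliqueEdges B

namespace PreservesTriangles

variable {ψ : Equiv.Perm (Sym2 V)}

theorem exists_mem_cliqueEdges (hψ : PreservesTriangles ψ) {a b c : V} (hab : a ≠ b) (hbc : b ≠ c)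
    (hac : a ≠ c) : ∃ B : Finset V, B.card = 3 ∧ ψ s(a, b) ∈ cliqueEdges B ∧
      ψ s(b, c) ∈ cliqueEdges B ∧ ψ s(a, c) ∈ cliqueEdges B := by
  classical
  obtain ⟨B, hB, h⟩ := hψ {a, b, c} (Finset.card_eq_three.2 ⟨a, b, c, hab, hac, hbc, rfl⟩)
  have h' : ∀ e ∈ cliqueEdges {a, b, c}, ψ e ∈ cliqueEdges B := fun e he => by
    rw [← h]; exact Finset.mem_map_of_mem _ he
  refine ⟨B, hB, ?_, ?_, ?_⟩ <;> apply h' <;> simp [mk_mem_cliqueEdges, *]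

/-- The image of the triangle abc is a triangle through ab and bc, hence abc itself, and by
injectivity ac is the only edge left for the image of ac. -/
theorem apply_third (hψ : PreservesTriangles ψ) {a b c : V} (hab : a ≠ b) (hbc : b ≠ c)
    (hac : a ≠ c) (h1 : ψ s(a, b) = s(a, b)) (h2 : ψ s(b, c) = s(b, c)) :
    ψ s(a, c) = s(a, c) := by
  classical
  obtain ⟨B, hB, h3, h4, h5⟩ := hψ.exists_mem_cliqueEdges hab hbc hac
  rw [h1, mk_mem_cliqueEdges] at h3
  rw [h2, mk_mem_cliqueEdges] at h4
  have hB' : {a, b, c} = B := by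
    refine Finset.eq_of_subset_of_card_le (by simp [Finset.insert_subset_iff, *]) ?_
    rw [hB, Finset.card_eq_three.2 ⟨a, b, c, hab, hac, hbc, rfl⟩]
  have h6 : ψ s(a, c) ≠ s(a, b) := fun h =>
    hbc (Sym2.congr_right.1 (ψ.injective (h.trans h1.symm))).symm
  have h7 : ψ s(a, c) ≠ s(b, c) := fun h =>
    hab (Sym2.congr_left.1 (ψ.injective (h.trans h2.symm)))
  generalize ψ s(a, c) = e at *
  induction e with
  | _ x y =>
    rw [mk_mem_cliqueEdges, ← hB'] at h5
    simp only [Finset.mem_insert, Finset.mem_singleton] at h5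
    obtain ⟨hxy, hx, hy⟩ := h5
    rw [Sym2.eq_iff]
    rw [ne_eq, Sym2.eq_iff] at h6 h7
    rcases hx with rfl | rfl | rfl <;> rcases hy with rfl | rfl | rfl <;> simp_all

/-- The images of ab and ad lie in a common triangle, and any two edges of a triangle meet. -/
theorem exists_mem_apply (hψ : PreservesTriangles ψ) {a b d : V} (hab : a ≠ b) (hd : a ≠ d)
    (h1 : ψ s(a, b) = s(a, b)) : a ∈ ψ s(a, d) ∨ b ∈ ψ s(a, d) := by
  classical
  by_cases hbd : b = d
  · subst hbd
    rw [h1]; simp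
  obtain ⟨B, hB, h3, -, h5⟩ := hψ.exists_mem_cliqueEdges hab hbd hd
  rw [h1, mk_mem_cliqueEdges] at h3
  generalize ψ s(a, d) = e at *
  induction e with
  | _ x y =>
    rw [mk_mem_cliqueEdges] at h5
    by_contra! hcon
    simp only [Sym2.mem_iff, not_or] at hcon
    have h6 : ({a, b, x, y} : Finset V) ⊆ B := by simp [Finset.insert_subset_iff, h3, h5]
    have h7 := Finset.card_le_card h6
    rw [hB, Finset.card_insert_of_notMem (by simp [hab, hcon]),
      Finset.card_insert_of_notMem (by simp [hcon]), Finset.card_pair h5.1] at h7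
    omega

/-- The image of ad meets both ab and ac. If it avoided a, it would be bc, which is already the
image of bc. -/
theorem mem_apply (hψ : PreservesTriangles ψ) {a b c d : V} (hab : a ≠ b) (hbc : b ≠ c)
    (hac : a ≠ c) (hd : a ≠ d) (h1 : ψ s(a, b) = s(a, b)) (h2 : ψ s(b, c) = s(b, c))
    (h3 : ψ s(a, c) = s(a, c)) : a ∈ ψ s(a, d) := by
  by_contra ha
  have hb := (hψ.exists_mem_apply hab hd h1).resolve_left ha
  have hc := (hψ.exists_mem_apply hac hd h3).resolve_left ha
  have h4 : ψ s(a, d) = s(b, c) := (Sym2.mem_and_mem_iff hbc).1 ⟨hb, hc⟩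
  have h5 := ψ.injective (h4.trans h2.symm)
  have h6 : a ∈ s(b, c) := h5 ▸ Sym2.mem_mk_left a d
  rcases Sym2.mem_iff.1 h6 with h | h
  · exact hab h
  · exact hac h

/-- The vertices of a path of two fixed edges. -/
def InFixedPath (ψ : Equiv.Perm (Sym2 V)) (v : V) : Prop :=
  ∃ a b c, a ≠ b ∧ b ≠ c ∧ a ≠ c ∧ ψ s(a, b) = s(a, b) ∧ ψ s(b, c) = s(b, c) ∧
    (v = a ∨ v = b ∨ v = c)

/-- The third edge of the triangle is fixed as well, so the three vertices of the path play
symmetric roles. -/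
theorem mem_apply_of_inFixedPath (hψ : PreservesTriangles ψ) {v w : V} (hv : InFixedPath ψ v)
    (hvw : v ≠ w) : v ∈ ψ s(v, w) := by
  obtain ⟨a, b, c, hab, hbc, hac, h1, h2, hv⟩ := hv
  have h3 := hψ.apply_third hab hbc hac h1 h2
  rcases hv with rfl | rfl | rfl
  · exact hψ.mem_apply hab hbc hac hvw h1 h2 h3
  · rw [Sym2.eq_swap] at h1
    exact hψ.mem_apply hab.symm hac hbc hvw h1 h3 h2
  · rw [Sym2.eq_swap] at h2 h3
    exact hψ.mem_apply hac.symm hab hbc.symm hvw h3 h1 h2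

/-- If all vertices but at most one lie on paths of two fixed edges, then all edges are fixed. -/
theorem apply_eq (hψ : PreservesTriangles ψ)
    (h : ∀ u v, ¬ InFixedPath ψ u → ¬ InFixedPath ψ v → u = v) {e : Sym2 V} (he : ¬ e.IsDiag) :
    ψ e = e := by
  classical
  have key : ∀ u v, u ≠ v → InFixedPath ψ u → InFixedPath ψ v → ψ s(u, v) = s(u, v) := by
    intro u v huv hu hv
    refine (Sym2.mem_and_mem_iff huv).1 ⟨hψ.mem_apply_of_inFixedPath hu huv, ?_⟩
    rw [Sym2.eq_swap]
    exact hψ.mem_apply_of_inFixedPath hv huv.symm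
  -- The image of uv has the form ux. If x were on a fixed path, ux would be its own image, contrary
  -- to injectivity; so x is the one vertex off the paths, which is v.
  have key2 : ∀ u v, u ≠ v → InFixedPath ψ u → ¬ InFixedPath ψ v → ψ s(u, v) = s(u, v) := by
    intro u v huv hu hv
    obtain ⟨x, hx⟩ := hψ.mem_apply_of_inFixedPath hu huv
    -- As `ψ` permutes all of `Sym2 V`, a diagonal image must be excluded: uv lies in a triangle,
    -- whose image consists of proper edges.
    by_cases hux : u = x
    · exfalso
      obtain ⟨w, hwu, hw⟩ : ∃ w, u ≠ w ∧ v ≠ w := by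
        obtain ⟨a, b, c, hab, hbc, hac, -⟩ := hu
        by_contra! hcon
        have ha := hcon a
        have hb := hcon b
        have hc := hcon c
        by_cases h1 : u = a <;> by_cases h2 : u = b <;> by_cases h3 : u = c <;> simp_all
      obtain ⟨B, -, h1, h2, h3⟩ := hψ.exists_mem_cliqueEdges huv hw hwu
      rw [hx, mk_mem_cliqueEdges] at h1
      exact h1.1 hux
    by_cases hxp : InFixedPath ψ x
    · have := ψ.injective (hx.trans (key u x hux hu hxp).symm)
      exact absurd (Sym2.congr_right.1 this ▸ hxp) hv
    · rw [hx, h x v hxp hv]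
  induction e with
  | _ u v =>
    have huv : u ≠ v := by simpa using he
    by_cases hu : InFixedPath ψ u
    · by_cases hv : InFixedPath ψ v
      · exact key u v huv hu hv
      · exact key2 u v huv hu hv
    · by_cases hv : InFixedPath ψ v
      · rw [Sym2.eq_swap]
        exact key2 v u huv.symm hv hu
      · exact absurd (h u v hu hv) huv

end PreservesTriangles

/-- The upper bound for a matroid on the edges of a complete graph whose automorphisms preserve
triangles. -/
theorem fixingNumber_le_of_preservesTriangles {n : ℕ} (hn : 3 ≤ n) {M : Matroid (Sym2 (Fin n))}
    (hE : M.E = (completeGraph (Fin n)).edgeSet)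
    (h : ∀ ψ : Equiv.Perm (Sym2 (Fin n)), (∀ C, M.IsCircuit C → M.IsCircuit (ψ '' C)) →
      PreservesTriangles ψ) : M.fixingNumber ≤ 2 * n / 3 := by
  classical
  have : NeZero n := ⟨by omega⟩
  -- Vertices are indexed by naturals modulo n, which keeps the index arithmetic within reach of
  -- `omega`.
  let v : ℕ → Fin n := Fin.ofNat n
  have hv : ∀ i j, i < n → j < n → i ≠ j → v i ≠ v j := by
    intro i j hi hj hij h
    rw [Fin.ext_iff, Fin.val_ofNat, Fin.val_ofNat, Nat.mod_eq_of_lt hi, Nat.mod_eq_of_lt hj] at h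
    exact hij h
  -- `S₁` and `S₂` form the paths 3m+1, 3m, 3m+2 with centre 3m. If n ≡ 2 mod 3, the edge in `S₃`
  -- attaches n-2 to the centre 0, so that only n-1 stays uncovered.
  let S₁ := (Finset.range (n / 3)).image fun m => s(v (3 * m), v (3 * m + 1))
  let S₂ := (Finset.range (n / 3)).image fun m => s(v (3 * m), v (3 * m + 2))
  let S₃ : Finset (Sym2 (Fin n)) := if n % 3 = 2 then {s(v 0, v (n - 2))} else ∅
  have hcard : ((S₁ ∪ S₂ ∪ S₃).subtype (· ∈ M.E)).card ≤ 2 * n / 3 := by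
    have h1 : S₁.card ≤ n / 3 := Finset.card_image_le.trans (by simp)
    have h2 : S₂.card ≤ n / 3 := Finset.card_image_le.trans (by simp)
    have h3 : S₃.card ≤ if n % 3 = 2 then 1 else 0 := by
      simp only [S₃]; split_ifs <;> simp
    have h4 := Finset.card_union_le (S₁ ∪ S₂) S₃
    have h5 := Finset.card_union_le S₁ S₂
    rw [Finset.card_subtype]
    refine (Finset.card_filter_le _ _).trans ?_
    split_ifs at h3 <;> omega
  refine (Matroid.IsFixingSet.fixingNumber_le ?_).trans hcard
  intro φ hφ hS
  obtain ⟨ψ, hψφ, hψ⟩ := hφ.exists_perm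
  have hE' : ∀ e : Sym2 (Fin n), e ∈ M.E ↔ ¬ e.IsDiag := fun e => by
    rw [hE, mem_completeGraph_edgeSet]
  have hfix : ∀ i j, i < n → j < n → i ≠ j → s(v i, v j) ∈ S₁ ∪ S₂ ∪ S₃ →
      ψ s(v i, v j) = s(v i, v j) := by
    intro i j hi hj hij hmem
    have he : s(v i, v j) ∈ M.E := (hE' _).2 (by simpa using hv i j hi hj hij)
    have h1 := hψφ ⟨_, he⟩
    rw [hS _ (Finset.mem_subtype.2 hmem)] at h1
    exact h1
  have hfix₁ : ∀ m < n / 3, ψ s(v (3 * m), v (3 * m + 1)) = s(v (3 * m), v (3 * m + 1)) := by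
    intro m hm
    refine hfix _ _ (by omega) (by omega) (by omega) ?_
    rw [Finset.mem_union, Finset.mem_union]
    exact Or.inl (Or.inl (Finset.mem_image.2 ⟨m, Finset.mem_range.2 hm, rfl⟩))
  have hfix₂ : ∀ m < n / 3, ψ s(v (3 * m), v (3 * m + 2)) = s(v (3 * m), v (3 * m + 2)) := by
    intro m hm
    refine hfix _ _ (by omega) (by omega) (by omega) ?_
    rw [Finset.mem_union, Finset.mem_union]
    exact Or.inl (Or.inr (Finset.mem_image.2 ⟨m, Finset.mem_range.2 hm, rfl⟩))
  have hpath : ∀ i, i + 1 < n → PreservesTriangles.InFixedPath ψ (v i) := by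
    intro i hi
    by_cases hi3 : i / 3 < n / 3
    · refine ⟨v (3 * (i / 3) + 1), v (3 * (i / 3)), v (3 * (i / 3) + 2),
        hv _ _ (by omega) (by omega) (by omega), hv _ _ (by omega) (by omega) (by omega),
        hv _ _ (by omega) (by omega) (by omega), ?_, hfix₂ _ hi3, ?_⟩
      · rw [Sym2.eq_swap]
        exact hfix₁ _ hi3
      · have : i = 3 * (i / 3) + 1 ∨ i = 3 * (i / 3) ∨ i = 3 * (i / 3) + 2 := by omega
        rcases this with h | h | h
        · exact Or.inl (congrArg v h)
        · exact Or.inr (Or.inl (congrArg v h))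
        · exact Or.inr (Or.inr (congrArg v h))
    -- A vertex beyond the full triples that is not the last one exists only for n ≡ 2 mod 3, and it
    -- is n-2. It forms a path with the edge 01 and the extra edge; n ≥ 5 here, so the three
    -- vertices are distinct.
    · have hn3 : n % 3 = 2 := by omega
      have hin : i = n - 2 := by omega
      have h01 := hfix₁ 0 (by omega)
      simp only [mul_zero, zero_add] at h01
      rw [Sym2.eq_swap] at h01
      refine ⟨v 1, v 0, v (n - 2), hv _ _ (by omega) (by omega) (by omega),
        hv _ _ (by omega) (by omega) (by omega), hv _ _ (by omega) (by omega) (by omega), h01,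
        hfix _ _ (by omega) (by omega) (by omega) ?_, Or.inr (Or.inr (congrArg v hin))⟩
      rw [Finset.mem_union]
      exact Or.inr (by simp [S₃, hn3])
  have hvx : ∀ x : Fin n, v x = x := fun x => Fin.ext (Nat.mod_eq_of_lt x.2)
  have hlast : ∀ x : Fin n, ¬ PreservesTriangles.InFixedPath ψ x → (x : ℕ) + 1 = n := by
    intro x hx
    by_contra hne
    refine hx ?_
    rw [← hvx x]
    exact hpath x (by omega)
  ext1 e
  apply Subtype.ext
  rw [← hψφ]
  refine (h ψ hψ).apply_eq (fun x y hx hy => Fin.ext ?_) ((hE' _).1 e.2)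
  have := hlast x hx
  have := hlast y hy
  omega

/-! ### Edges of a complete graph and their relabelling -/

theorem natCard_edgeSet_completeGraph (n : ℕ) :
    Nat.card (completeGraph (Fin n)).edgeSet = n.choose 2 := by
  have h : (completeGraph (Fin n)).edgeSet = ↑(cliqueEdges (Finset.univ : Finset (Fin n))) := by
    ext e
    simp [mem_cliqueEdges]
  rw [h, Nat.card_coe_set_eq, Set.ncard_coe_finset, card_cliqueEdges, Finset.card_univ,
    Fintype.card_fin]

theorem coe_subset_edgeSet_completeGraph {S : Finset (Sym2 V)} :
    (S : Set (Sym2 V)) ⊆ (completeGraph V).edgeSet ↔ ∀ e ∈ S, ¬ e.IsDiag :=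
  forall₂_congr fun _ _ => mem_completeGraph_edgeSet

theorem image_map_equiv_subset_edgeSet {σ : Equiv.Perm V} {I : Set (Sym2 V)}
    (hI : I ⊆ (completeGraph V).edgeSet) : Sym2.map σ '' I ⊆ (completeGraph V).edgeSet := by
  rintro _ ⟨e, he, rfl⟩
  rw [mem_completeGraph_edgeSet, Sym2.isDiag_map σ.injective]
  exact mem_completeGraph_edgeSet.1 (hI he)

theorem image_map_symm_image_map (σ : Equiv.Perm V) (I : Set (Sym2 V)) :
    Sym2.map σ.symm '' (Sym2.map σ '' I) = I := by
  simp [Set.image_image, Sym2.map_map, Sym2.map_id']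

/-! ### The cycle matroid of a complete graph -/

theorem cycleMatroid_dep_iff [Finite V] {G : SimpleGraph V} {D : Set (Sym2 V)} :
    G.cycleMatroid.Dep D ↔ D ⊆ G.edgeSet ∧ ∃ C, G.IsCycleEdgeSet C ∧ C ⊆ D := by
  change ¬ G.IsForestEdgeSet D ∧ D ⊆ G.edgeSet ↔ _
  rw [and_comm]
  refine and_congr_right fun hD => ?_
  rw [IsForestEdgeSet, and_iff_right hD]
  push Not
  rfl

theorem IsCycleEdgeSet.image_map_equiv {σ : Equiv.Perm V} {C : Set (Sym2 V)}
    (hC : (completeGraph V).IsCycleEdgeSet C) :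
    (completeGraph V).IsCycleEdgeSet (Sym2.map σ '' C) := by
  obtain ⟨u, c, hc, rfl⟩ := hC
  let f : completeGraph V →g completeGraph V := ⟨σ, fun h => σ.injective.ne h⟩
  exact ⟨_, c.map f, hc.map σ.injective, (Walk.edgeSet_map f c).symm⟩

theorem IsForestEdgeSet.image_map_equiv (σ : Equiv.Perm V) {I : Set (Sym2 V)}
    (hI : (completeGraph V).IsForestEdgeSet I) :
    (completeGraph V).IsForestEdgeSet (Sym2.map σ '' I) := by
  refine ⟨image_map_equiv_subset_edgeSet hI.1, fun C hC hCI => ?_⟩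
  refine hI.2 _ (hC.image_map_equiv (σ := σ.symm)) ?_
  rw [← image_map_symm_image_map σ I]
  exact Set.image_mono hCI

/-- The set `A` is the vertex set of the cycle; a cycle has as many edges as vertices. -/
theorem IsCycleEdgeSet.exists_card_support {G : SimpleGraph V} {C : Set (Sym2 V)}
    (hC : G.IsCycleEdgeSet C) : ∃ A : Finset V, 3 ≤ A.card ∧ C.encard = A.card ∧
      C ⊆ cliqueEdges A := by
  classical
  obtain ⟨u, c, hc, rfl⟩ := hC
  refine ⟨c.support.toFinset, ?_, ?_, ?_⟩
  · rw [card_support_isCycle hc]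
    exact hc.three_le_length
  · have h : c.edgeSet = ↑c.edges.toFinset := by ext e; simp [Walk.edgeSet]
    rw [h, Set.encard_coe_eq_coe_finsetCard, card_support_isCycle hc,
      List.toFinset_card_of_nodup hc.isTrail.edges_nodup, Walk.length_edges]
  · intro e he
    induction e with
    | _ x y =>
      rw [Finset.mem_coe, mk_mem_cliqueEdges, List.mem_toFinset, List.mem_toFinset]
      exact ⟨(c.adj_of_mem_edges he).ne, c.fst_mem_support_of_mem_edges he,
        c.snd_mem_support_of_mem_edges he⟩

theorem isCycleEdgeSet_cliqueEdges {A : Finset V} (hA : A.card = 3) :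
    (completeGraph V).IsCycleEdgeSet (cliqueEdges A) := by
  classical
  obtain ⟨a, b, c, hab, hac, hbc, rfl⟩ := Finset.card_eq_three.1 hA
  have h1 : (completeGraph V).Adj a b := hab
  have h2 : (completeGraph V).Adj b c := hbc
  have h3 : (completeGraph V).Adj c a := hac.symm
  refine ⟨a, Walk.cons h1 (Walk.cons h2 (Walk.cons h3 Walk.nil)), ?_, ?_⟩
  · rw [Walk.cons_isCycle_iff]
    constructor
    · simp [hab.symm, hac.symm, hbc]
    · simp [hab, hac, hbc, hab.symm]
  · ext e
    induction e with
    | _ x y =>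
      rw [Finset.mem_coe, mk_mem_cliqueEdges]
      simp only [Finset.mem_insert, Finset.mem_singleton, Walk.edgeSet, Walk.edges_cons,
        Walk.edges_nil, List.mem_cons, List.not_mem_nil, or_false, Set.mem_ofPred_eq, Sym2.eq_iff]
      constructor
      · rintro ⟨hxy, rfl | rfl | rfl, rfl | rfl | rfl⟩ <;> simp_all
      · rintro ((⟨rfl, rfl⟩ | ⟨rfl, rfl⟩) | (⟨rfl, rfl⟩ | ⟨rfl, rfl⟩) | (⟨rfl, rfl⟩ | ⟨rfl, rfl⟩)) <;>
          simp [*, Ne.symm]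

/-- A cycle inside a set of three edges has at least three edges, so it is the whole set; it has
three vertices and therefore uses all edges between them. -/
theorem cycleMatroid_isCircuit_card_three_iff [Finite V] {C : Finset (Sym2 V)}
    (hC : C.card = 3) : (completeGraph V).cycleMatroid.IsCircuit C ↔
      ∃ A : Finset V, A.card = 3 ∧ C = cliqueEdges A := by
  have key : ∀ D ⊆ (C : Set (Sym2 V)), (completeGraph V).IsCycleEdgeSet D →
      D = C ∧ ∃ A : Finset V, A.card = 3 ∧ C = cliqueEdges A := by
    intro D hDC hD
    obtain ⟨A, hA, hDA, hsub⟩ := hD.exists_card_support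
    lift D to Finset (Sym2 V) using (Finset.finite_toSet C).subset hDC
    rw [Set.encard_coe_eq_coe_finsetCard, Nat.cast_inj] at hDA
    rw [Finset.coe_subset] at hDC hsub
    have h1 := Finset.card_le_card hDC
    have h2 : D = C := Finset.eq_of_subset_of_card_le hDC (by omega)
    subst h2
    refine ⟨rfl, A, by omega, Finset.eq_of_subset_of_card_le hsub ?_⟩
    rw [card_cliqueEdges, show A.card = 3 by omega, hC]
    decide
  rw [Matroid.isCircuit_iff]
  constructor
  · rintro ⟨hC, -⟩
    obtain ⟨-, D, hD, hDC⟩ := cycleMatroid_dep_iff.1 hC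
    exact (key D hDC hD).2
  · rintro ⟨A, hA, hCA⟩
    refine ⟨cycleMatroid_dep_iff.2 ⟨?_, _, isCycleEdgeSet_cliqueEdges hA, by rw [hCA]⟩, ?_⟩
    · rw [coe_subset_edgeSet_completeGraph, hCA]
      exact fun e he => (mem_cliqueEdges.1 he).1
    · intro D hD hDC
      obtain ⟨-, D', hD', hDD'⟩ := cycleMatroid_dep_iff.1 hD
      have := (key D' (hDD'.trans hDC) hD').1
      exact hDC.antisymm (this ▸ hDD')

theorem preservesTriangles_of_cycleMatroid [Finite V] {ψ : Equiv.Perm (Sym2 V)}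
    (hψ : ∀ C, (completeGraph V).cycleMatroid.IsCircuit C →
      (completeGraph V).cycleMatroid.IsCircuit (ψ '' C)) : PreservesTriangles ψ := by
  intro A hA
  have hc : (cliqueEdges A).card = 3 := by rw [card_cliqueEdges, hA]; decide
  have h := hψ _ ((cycleMatroid_isCircuit_card_three_iff hc).2 ⟨A, hA, rfl⟩)
  have h' : ψ '' ↑(cliqueEdges A) = ↑((cliqueEdges A).map ψ.toEmbedding) := by simp
  rw [h'] at h
  exact (cycleMatroid_isCircuit_card_three_iff (by rw [Finset.card_map, hc])).1 h

theorem fixingNumber_cycleMatroid_completeGraph {n : ℕ} (hn : 3 ≤ n) :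
    (completeGraph (Fin n)).cycleMatroid.fixingNumber = 2 * n / 3 := by
  refine le_antisymm (fixingNumber_le_of_preservesTriangles hn rfl fun ψ hψ =>
    preservesTriangles_of_cycleMatroid hψ) (Matroid.le_fixingNumber fun S hS => ?_)
  have := two_mul_card_le_of_isFixingSet (by simpa using hn) rfl
    (fun σ _ hI => IsForestEdgeSet.image_map_equiv σ hI) hS
  rw [Fintype.card_fin] at this
  -- The bound 3|S| ≥ 2n - 2 rounds up to |S| ≥ ⌊2n/3⌋.
  omega

/-! ### The bicircular matroid of a complete graph -/

/-- From here on bicycles are replaced by the comparison of numbers of edges and vertices. -/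
theorem bicircularMatroid_indep_iff [Finite V] {G : SimpleGraph V} {I : Set (Sym2 V)} :
    G.bicircularMatroid.Indep I ↔ I ⊆ G.edgeSet ∧ IsSparse I := by
  rw [← isBicycleFree_iff]
  rfl

/-- Pulling a set of edges back along `σ` keeps its size and does not increase the number of
incident vertices. -/
theorem IsSparse.image_map_equiv (σ : Equiv.Perm V) {I : Set (Sym2 V)} (hI : IsSparse I) :
    IsSparse (Sym2.map σ '' I) := by
  classical
  intro A hA
  have hinv : ∀ e : Sym2 V, Sym2.map σ.symm (Sym2.map σ e) = e := fun e => by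
    induction e with
    | _ x y => simp
  have h1 : (A.image (Sym2.map σ.symm)).card = A.card :=
    Finset.card_image_of_injective _ (Sym2.map.injective σ.symm.injective)
  have h2 : edgeVerts (A.image (Sym2.map σ.symm)) ⊆ (edgeVerts A).image σ.symm := by
    intro v hv
    obtain ⟨e, he, hve⟩ := mem_edgeVerts.1 hv
    obtain ⟨f, hf, rfl⟩ := Finset.mem_image.1 he
    obtain ⟨w, hw, rfl⟩ := Sym2.mem_map.1 hve
    exact Finset.mem_image_of_mem _ (mem_edgeVerts.2 ⟨f, hf, hw⟩)
  have h3 := (Finset.card_le_card h2).trans Finset.card_image_le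
  have h4 := hI (A.image (Sym2.map σ.symm)) (by
    rw [Finset.coe_image]
    rintro _ ⟨e, he, rfl⟩
    obtain ⟨f, hf, rfl⟩ := hA he
    rwa [hinv])
  omega

/-- A set of at most four edges of a simple graph has at most as many elements as it has incident
vertices. -/
theorem card_le_card_edgeVerts {A : Finset (Sym2 V)} (hA : ∀ e ∈ A, ¬ e.IsDiag)
    (h4 : A.card ≤ 4) : A.card ≤ (edgeVerts A).card := by
  have h := Finset.card_le_card ((edgeVerts_subset_iff hA).1 subset_rfl)
  rw [card_cliqueEdges] at h
  by_contra! hlt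
  -- With fewer vertices than edges there would be at most three vertices, and k ≤ 3 vertices carry
  -- at most k edges.
  have h3 : ∀ k < 4, k.choose 2 ≤ k := by decide
  have := h3 (edgeVerts A).card (by omega)
  omega

theorem bicircularMatroid_indep_of_card_le_four [Finite V] {A : Finset (Sym2 V)}
    (hA : ∀ e ∈ A, ¬ e.IsDiag) (h4 : A.card ≤ 4) :
    (completeGraph V).bicircularMatroid.Indep A := by
  refine bicircularMatroid_indep_iff.2 ⟨coe_subset_edgeSet_completeGraph.2 hA, fun B hB => ?_⟩
  rw [Finset.coe_subset] at hB
  exact card_le_card_edgeVerts (fun e he => hA e (hB he)) ((Finset.card_le_card hB).trans h4)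

/-- Five edges on at most four vertices violate sparsity, while every proper subset has at most four
edges and is independent. -/
theorem bicircularMatroid_isCircuit_of_card_five [Finite V] {C : Finset (Sym2 V)}
    (hC : C.card = 5) {A : Finset V} (hA : A.card ≤ 4) (hCA : C ⊆ cliqueEdges A) :
    (completeGraph V).bicircularMatroid.IsCircuit C := by
  have hd : ∀ e ∈ C, ¬ e.IsDiag := fun e he => (mem_cliqueEdges.1 (hCA he)).1
  have hv := Finset.card_le_card ((edgeVerts_subset_iff hd).2 hCA)
  have hE : (C : Set (Sym2 V)) ⊆ (completeGraph V).bicircularMatroid.E :=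
    coe_subset_edgeSet_completeGraph.2 hd
  rw [Matroid.isCircuit_iff_forall_ssubset]
  refine ⟨⟨fun h => ?_, hE⟩, fun I hI => ?_⟩
  · have := (bicircularMatroid_indep_iff.1 h).2 C subset_rfl
    omega
  · lift I to Finset (Sym2 V) using (Finset.finite_toSet C).subset hI.subset
    rw [Finset.coe_ssubset] at hI
    have := Finset.card_lt_card hI
    exact bicircularMatroid_indep_of_card_le_four (fun e he => hd e (hI.subset he)) (by omega)

/-- Proper subsets of a circuit are independent, so the failure of sparsity can only occur at the
circuit itself. -/
theorem card_edgeVerts_lt_of_isCircuit [Finite V] {C : Finset (Sym2 V)}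
    (hC : (completeGraph V).bicircularMatroid.IsCircuit C) : (edgeVerts C).card < C.card := by
  by_contra! hle
  refine hC.not_indep (bicircularMatroid_indep_iff.2 ⟨hC.subset_ground, fun B hB => ?_⟩)
  rw [Finset.coe_subset] at hB
  rcases hB.eq_or_ssubset with rfl | hB
  · exact hle
  · have h := (Matroid.isCircuit_iff_forall_ssubset.1 hC).2 (Finset.coe_ssubset.2 hB)
    exact (bicircularMatroid_indep_iff.1 h).2 B subset_rfl

theorem not_isDiag_of_isCircuit [Finite V] {C : Finset (Sym2 V)}
    (hC : (completeGraph V).bicircularMatroid.IsCircuit C) : ∀ e ∈ C, ¬ e.IsDiag :=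
  coe_subset_edgeSet_completeGraph.1 hC.subset_ground

/-- The complete graphs on four vertices are the sets of six edges all of whose subsets with five
elements are circuits of the bicircular matroid. -/
theorem forall_erase_isCircuit_iff [Finite V] [DecidableEq (Sym2 V)] {Q : Finset (Sym2 V)}
    (hQ : Q.card = 6) :
    (∀ e ∈ Q, (completeGraph V).bicircularMatroid.IsCircuit ↑(Q.erase e)) ↔
      ∃ A : Finset V, A.card = 4 ∧ Q = cliqueEdges A := by
  classical
  constructor
  · intro h
    obtain ⟨e, he, f, hf, hef⟩ := Finset.one_lt_card.1 (show 1 < Q.card by omega)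
    have hce := Finset.card_erase_of_mem he
    have hcf := Finset.card_erase_of_mem hf
    have hve := card_edgeVerts_lt_of_isCircuit (h e he)
    have hvf := card_edgeVerts_lt_of_isCircuit (h f hf)
    have hde := not_isDiag_of_isCircuit (h e he)
    have hdf := not_isDiag_of_isCircuit (h f hf)
    have hcef : ((Q.erase e).erase f).card = 4 := by
      rw [Finset.card_erase_of_mem (Finset.mem_erase.2 ⟨hef.symm, hf⟩)]; omega
    -- The four edges common to both circuits already meet at least four vertices, while each
    -- circuit meets at most four. So all three sets have the same four vertices.
    have hv := card_le_card_edgeVerts (A := (Q.erase e).erase f)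
      (fun x hx => hde x (Finset.mem_of_mem_erase hx)) hcef.le
    have h1 : edgeVerts ((Q.erase e).erase f) = edgeVerts (Q.erase e) :=
      Finset.eq_of_subset_of_card_le (edgeVerts_mono (Finset.erase_subset _ _)) (by omega)
    have h2 : edgeVerts ((Q.erase e).erase f) = edgeVerts (Q.erase f) :=
      Finset.eq_of_subset_of_card_le (edgeVerts_mono
        (Finset.erase_subset_erase _ (Finset.erase_subset _ _))) (by omega)
    have hA : (edgeVerts (Q.erase e)).card = 4 := by
      rw [h1] at hv; omega
    refine ⟨_, hA, Finset.eq_of_subset_of_card_le ?_ ?_⟩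
    · intro x hx
      by_cases hxe : x = e
      · have hx' : x ∈ Q.erase f := Finset.mem_erase.2 ⟨hxe ▸ hef, hx⟩
        rw [← h1, h2]
        exact (edgeVerts_subset_iff hdf).1 subset_rfl hx'
      · exact (edgeVerts_subset_iff hde).1 subset_rfl (Finset.mem_erase.2 ⟨hxe, hx⟩)
    · rw [card_cliqueEdges, hA, hQ]; decide
  · rintro ⟨A, hA, rfl⟩ e he
    refine bicircularMatroid_isCircuit_of_card_five ?_ hA.le (Finset.erase_subset _ _)
    rw [Finset.card_erase_of_mem he, hQ]

/-- Copies of K_4 are recognised by their circuits, hence preserved. With two vertices x, y outside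
a triangle A, available since n ≥ 5, the triangle is the intersection of the copies of K_4 on A + x
and A + y, and its image is again an intersection of two copies. -/
theorem preservesTriangles_of_bicircularMatroid [Fintype V] (hV : 5 ≤ Fintype.card V)
    {ψ : Equiv.Perm (Sym2 V)}
    (hψ : ∀ C, (completeGraph V).bicircularMatroid.IsCircuit C →
      (completeGraph V).bicircularMatroid.IsCircuit (ψ '' C)) : PreservesTriangles ψ := by
  classical
  have hK : ∀ A : Finset V, A.card = 4 →
      ∃ B : Finset V, B.card = 4 ∧ (cliqueEdges A).map ψ.toEmbedding = cliqueEdges B := by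
    intro A hA
    have hc : (cliqueEdges A).card = 6 := by rw [card_cliqueEdges, hA]; decide
    have h := (forall_erase_isCircuit_iff hc).2 ⟨A, hA, rfl⟩
    refine (forall_erase_isCircuit_iff (by rw [Finset.card_map, hc])).1 fun e he => ?_
    obtain ⟨f, hf, rfl⟩ := Finset.mem_map.1 he
    have h' := hψ _ (h f hf)
    rwa [← Finset.map_erase, Finset.coe_map]
  intro A hA
  obtain ⟨x, hx, y, hy, hxy⟩ : ∃ x ∈ Aᶜ, ∃ y ∈ Aᶜ, x ≠ y := by
    rw [← Finset.one_lt_card, Finset.card_compl]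
    omega
  rw [Finset.mem_compl] at hx hy
  obtain ⟨B, -, hB⟩ := hK (insert x A) (by rw [Finset.card_insert_of_notMem hx, hA])
  obtain ⟨B', -, hB'⟩ := hK (insert y A) (by rw [Finset.card_insert_of_notMem hy, hA])
  have h1 : insert x A ∩ insert y A = A := by grind
  have h2 : (cliqueEdges A).map ψ.toEmbedding = cliqueEdges (B ∩ B') := by
    rw [← h1, ← cliqueEdges_inter, Finset.map_inter, hB, hB', cliqueEdges_inter]
  refine ⟨B ∩ B', ?_, h2⟩
  have h3 := congrArg Finset.card h2
  rw [Finset.card_map, card_cliqueEdges, card_cliqueEdges, hA] at h3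
  -- The size of the intersection is recovered from its number of edges: k choose 2 equals 3 only
  -- for k = 3.
  have h4 : ¬ (B ∩ B').card ≤ 2 := fun h => by
    have := Nat.choose_le_choose 2 h
    simp [Nat.choose] at this h3
    omega
  have h5 : ¬ 4 ≤ (B ∩ B').card := fun h => by
    have := Nat.choose_le_choose 2 h
    simp [Nat.choose] at this h3
    omega
  omega

/-- Unlike the upper bound, this needs only a third vertex; the case n = 3 of the main theorem
relies on it. -/
theorem le_fixingNumber_bicircularMatroid_completeGraph {n : ℕ} (hn : 3 ≤ n) :
    2 * n / 3 ≤ (completeGraph (Fin n)).bicircularMatroid.fixingNumber := by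
  refine Matroid.le_fixingNumber fun S hS => ?_
  have := two_mul_card_le_of_isFixingSet (by simpa using hn) rfl (fun σ I hI => by
    rw [bicircularMatroid_indep_iff] at hI ⊢
    exact ⟨image_map_equiv_subset_edgeSet hI.1, hI.2.image_map_equiv σ⟩) hS
  rw [Fintype.card_fin] at this
  omega

theorem fixingNumber_bicircularMatroid_completeGraph {n : ℕ} (hn : 5 ≤ n) :
    (completeGraph (Fin n)).bicircularMatroid.fixingNumber = 2 * n / 3 :=
  le_antisymm (fixingNumber_le_of_preservesTriangles (by omega) rfl fun _ hψ =>
    preservesTriangles_of_bicircularMatroid (by simpa using hn) hψ)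
    (le_fixingNumber_bicircularMatroid_completeGraph (by omega))

/-- The circuits of the bicircular matroid of the complete graph on four vertices are the sets of
five edges. -/
theorem bicircularMatroid_four_isCircuit_iff {C : Finset (Sym2 (Fin 4))}
    (hC : ∀ e ∈ C, ¬ e.IsDiag) :
    (completeGraph (Fin 4)).bicircularMatroid.IsCircuit C ↔ C.card = 5 := by
  have hsub : ∀ D : Finset (Sym2 (Fin 4)), (∀ e ∈ D, ¬ e.IsDiag) → D.card = 5 →
      (completeGraph (Fin 4)).bicircularMatroid.IsCircuit D := fun D hD h =>
    bicircularMatroid_isCircuit_of_card_five h (A := Finset.univ) (by simp)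
      ((edgeVerts_subset_iff hD).1 (Finset.subset_univ _))
  refine ⟨fun h => ?_, hsub C hC⟩
  have h5 : 5 ≤ C.card := by
    by_contra! hlt
    exact h.not_indep (bicircularMatroid_indep_of_card_le_four hC (by omega))
  -- A circuit with at least five edges contains a circuit of exactly five, and circuits form an
  -- antichain.
  obtain ⟨D, hDC, hD⟩ := Finset.exists_subset_card_eq h5
  have h' := (hsub D (fun e he => hC e (hDC he)) hD).eq_of_subset_isCircuit h
    (Finset.coe_subset.2 hDC)
  rw [← Finset.coe_inj.1 h', hD]

/-- Whether a set is a circuit depends only on its size, so all permutations of the six edges are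
automorphisms. -/
theorem fixingNumber_bicircularMatroid_four :
    (completeGraph (Fin 4)).bicircularMatroid.fixingNumber = 5 := by
  rw [Matroid.fixingNumber_eq_natCard_sub_one]
  · change Nat.card (completeGraph (Fin 4)).edgeSet - 1 = 5
    rw [natCard_edgeSet_completeGraph]
    decide
  intro φ C
  have key : ∀ C : Set (completeGraph (Fin 4)).bicircularMatroid.E,
      (completeGraph (Fin 4)).bicircularMatroid.IsCircuit (Subtype.val '' C) ↔ C.ncard = 5 := by
    intro C
    have hfin := Set.toFinite (Subtype.val '' C : Set (Sym2 (Fin 4)))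
    rw [← Set.ncard_image_of_injective C Subtype.val_injective, ← hfin.coe_toFinset,
      bicircularMatroid_four_isCircuit_iff, Set.ncard_coe_finset]
    intro e he
    obtain ⟨f, -, rfl⟩ := hfin.mem_toFinset.1 he
    exact mem_completeGraph_edgeSet.1 f.2
  rw [key, key, Set.ncard_image_of_injective C φ.injective]

/-- The upper bound for graphs with few edges. -/
theorem fixingNumber_le_choose_two_sub_one {n : ℕ} {M : Matroid (Sym2 (Fin n))}
    (hE : M.E = (completeGraph (Fin n)).edgeSet) : M.fixingNumber ≤ n.choose 2 - 1 := by
  rw [← natCard_edgeSet_completeGraph, ← hE]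
  exact Matroid.fixingNumber_le_natCard_sub_one

end SimpleGraph

/-! ### Assembly of the cases -/

theorem corollary4p8 :
    (∀ n : ℕ, 1 ≤ n → n ≠ 2 →
      (SimpleGraph.completeGraph (Fin n)).cycleMatroid.fixingNumber = 2 * n / 3) ∧
    (SimpleGraph.completeGraph (Fin 2)).cycleMatroid.fixingNumber = 0 ∧
    (SimpleGraph.completeGraph (Fin 4)).bicircularMatroid.fixingNumber = 5 ∧
    (SimpleGraph.completeGraph (Fin 2)).bicircularMatroid.fixingNumber = 0 ∧
    (∀ n : ℕ, n ≠ 2 → n ≠ 4 →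
      (SimpleGraph.completeGraph (Fin n)).bicircularMatroid.fixingNumber = 2 * n / 3) := by
  refine ⟨fun n h1 h2 => ?_, ?_, SimpleGraph.fixingNumber_bicircularMatroid_four, ?_,
    fun n h2 h4 => ?_⟩
  · obtain rfl | hn : n = 1 ∨ 3 ≤ n := by omega
    -- With at most one edge, `n.choose 2 - 1` is 0, by truncated subtraction if there is none.
    · exact Nat.le_zero.1 (SimpleGraph.fixingNumber_le_choose_two_sub_one rfl)
    · exact SimpleGraph.fixingNumber_cycleMatroid_completeGraph hn
  · exact Nat.le_zero.1 (SimpleGraph.fixingNumber_le_choose_two_sub_one rfl)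
  · exact Nat.le_zero.1 (SimpleGraph.fixingNumber_le_choose_two_sub_one rfl)
  · obtain rfl | rfl | rfl | hn : n = 0 ∨ n = 1 ∨ n = 3 ∨ 5 ≤ n := by omega
    · exact Nat.le_zero.1 (SimpleGraph.fixingNumber_le_choose_two_sub_one rfl)
    · exact Nat.le_zero.1 (SimpleGraph.fixingNumber_le_choose_two_sub_one rfl)
    -- For n = 3 the recognition of triangles through K_4 is not available, but leaving out one of
    -- the three edges gives the bound 2 = 2 * 3 / 3.
    · exact le_antisymm (SimpleGraph.fixingNumber_le_choose_two_sub_one rfl)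
        (SimpleGraph.le_fixingNumber_bicircularMatroid_completeGraph le_rfl)
    · exact SimpleGraph.fixingNumber_bicircularMatroid_completeGraph hn
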